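/- Work over $\mathbb C$. For an integer $K\ge0$ let $i,j$ run through $\pm1,\dots,\pm K$, put $\bar\imath=0$ for $i>0$ and $\bar\imath=1$ for $i<0$, and let $\mathfrak{gl}_{K|K}$ be the Lie superalgebra of complex matrices with rows and columns indexed by $\pm1,\dots,\pm K$, where the matrix unit $E_{ij}$ has degree $\bar\imath+\bar\jmath\in\mathbb Z/2$. The queer Lie superalgebra $\mathfrak q_K\subset\mathfrak{gl}_{K|K}$ is the fixed point subalgebra of the automorphism $E_{ij}\mapsto E_{-i,-j}$; it is spanned by the elements $F_{ij}=E_{ij}+E_{-i,-j}$. In its universal enveloping algebra $\mathrm U(\mathfrak q_K)$ put, for $n\ge1$, $$F^{(n)}_{ij|K}=\sum_{k_1,\dots,k_{n-1}}(-1)^{\bar k_1+\dots+\bar k_{n-1}}F_{ik_1}F_{k_1k_2}\cdots F_{k_{n-1}j},\qquad C^{(n)}_K=\sum_kF^{(n)}_{kk|K},$$ where all summation indices run through $\pm1,\dots,\pm K$ (so $F^{(1)}_{ij|K}=F_{ij}$). For $N,M\ge0$ let $\mathrm A_N^M$ be the centralizer, in the sense of supercommutators, in $\mathrm U(\mathfrak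 q_{N+M})$ of the subalgebra $\mathfrak q_M\subset\mathfrak q_{N+M}$ spanned by the $F_{ij}$ with $|i|,|j|>N$; thus $\mathrm A_N^0=\mathrm U(\mathfrak q_N)$. Now let $N\ge0$ and $M\ge1$, let $\mathrm I_{N+M}$ be the right ideal of $\mathrm U(\mathfrak q_{N+M})$ generated by $F_{N+M,\pm1},\dots,F_{N+M,\pm(N+M)}$, and consider the canonical homomorphism $\mathrm U(\mathfrak q_{N+M-1})\to\mathrm U(\mathfrak q_{N+M})$ extending the inclusion of $\mathfrak q_{N+M-1}$ as the span of the $F_{ij}$ with $|i|,|j|<N+M$. Proposition 1.4. The canonical homomorphism $\mathrm U(\mathfrak q_{N+M-1})\to\mathrm U(\mathfrak q_{N+M})$ maps no non-zero element into $\mathrm I_{N+M}$; in particular it is injective, and we regard $\mathrm U(\mathfrak q_{N+M-1})$ and $\mathrm A_N^{M-1}$ as subalgebras of $\mathrm U(\mathfrak q_{N+M})$. One has $\mathrm A_N^M\subset\mathrm A_N^{M-1}\oplus\mathrm I_{N+M}$, and the projection $\alpha_M:\mathrm A_N^M\to\mathrm A_N^{M-1}$ along $\mathrm I_{N+M}$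 (that is, $\alpha_M(X)$ is the unique element of $\mathrm A_N^{M-1}$ with $X-\alpha_M(X)\in\mathrm I_{N+M}$) is a homomorphism of unital associative algebras. For every $n\ge1$ and all $i,j$ with $1\le|i|,|j|\le N$ the elements $F^{(n)}_{ij|N+M}$ and $C^{(n)}_{N+M}$ belong to $\mathrm A_N^M$, and $$\alpha_M\bigl(F^{(n)}_{ij|N+M}\bigr)=F^{(n)}_{ij|N+M-1},\qquad \alpha_M\bigl(C^{(n)}_{N+M}\bigr)=C^{(n)}_{N+M-1}.$$ (The equality for $C^{(n)}$ is also asserted when $N=0$.) -/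

import Mathlib

namespace QueerLie

open scoped BigOperators

/-- The set of indices `±1, …, ±K`: the pair `(a, 0)` stands for the index `a + 1` and the pair
`(a, 1)` for the index `-(a + 1)`, where `a = 0, …, K - 1`. The second component is the parity of
the index. -/
abbrev Idx (K : ℕ) : Type := Fin K × ZMod 2

/-- The index `-i`. -/
def Idx.opp {K : ℕ} (i : Idx K) : Idx K := (i.1, i.2 + 1)

/-- An index `i` with `|i| ≤ K`, regarded as an index with `|i| ≤ L`, where `K ≤ L`. -/
def Idx.cast {K L : ℕ} (h : K ≤ L) (i : Idx K) : Idx L := (Fin.castLE h i.1, i.2)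

/-- The absolute value of an index. -/
def Idx.abs {K : ℕ} (i : Idx K) : ℕ := i.1.val + 1

/-- The sign `(-1) ^ p` of an element `p` of `ℤ / 2`. -/
noncomputable def sgn (p : ZMod 2) : ℂ := (-1) ^ p.val

theorem sgn_zero : sgn 0 = 1 := by simp [sgn]

theorem sgn_one : sgn 1 = -1 := by simp [sgn, ZMod.val_one]

theorem zmod_two_cases (p : ZMod 2) : p = 0 ∨ p = 1 := by
  revert p; decide

theorem sgn_add (p q : ZMod 2) : sgn (p + q) = sgn p * sgn q := by
  have h : (1 : ZMod 2) + 1 = 0 := by decide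
  rcases zmod_two_cases p with rfl | rfl <;> rcases zmod_two_cases q with rfl | rfl <;>
    simp [sgn_zero, sgn_one, h]

theorem sgn_mul_self (p : ZMod 2) : sgn p * sgn p = 1 := by
  rcases zmod_two_cases p with rfl | rfl <;> simp [sgn_zero, sgn_one]

theorem opp_opp {K : ℕ} (i : Idx K) : i.opp.opp = i := by
  have h : ∀ p : ZMod 2, p + 1 + 1 = p := by decide
  ext <;> simp [Idx.opp, h]

/-- The permutation `i ↦ -i` of the index set. -/
def oppEquiv (K : ℕ) : Idx K ≃ Idx K := ⟨Idx.opp, Idx.opp, opp_opp, opp_opp⟩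

/-- Complex matrices with rows and columns indexed by `±1, …, ±K`. -/
abbrev Mat (K : ℕ) : Type := Matrix (Idx K) (Idx K) ℂ

/-- The queer Lie superalgebra `𝔮_K`: the fixed points in `𝔤𝔩_{K|K}` of the automorphism `η` sending
the matrix unit `E_{ij}` to `E_{-i,-j}`. As a set of matrices it is closed under the matrix
multiplication, and it is recorded here with this structure of an associative algebra. -/
def q (K : ℕ) : Subalgebra ℂ (Mat K) where
  carrier := {X | X.submatrix Idx.opp Idx.opp = X}
  mul_mem' {X Y} hX hY := by
    have h : (X * Y).submatrix (oppEquiv K) (oppEquiv K)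
        = X.submatrix (oppEquiv K) (oppEquiv K) * Y.submatrix (oppEquiv K) (oppEquiv K) :=
      (Matrix.submatrix_mul_equiv X Y _ (oppEquiv K) _).symm
    have hX' : X.submatrix (oppEquiv K) (oppEquiv K) = X := hX
    have hY' : Y.submatrix (oppEquiv K) (oppEquiv K) = Y := hY
    rw [hX', hY'] at h
    exact h
  add_mem' {X Y} hX hY := by
    simp only [Set.mem_ofPred_eq] at hX hY ⊢
    rw [Matrix.submatrix_add, Pi.add_apply, Pi.add_apply, hX, hY]
  algebraMap_mem' r := by
    ext i j
    have h : i.opp = j.opp ↔ i = j := (oppEquiv K).injective.eq_iff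
    simp [Matrix.algebraMap_matrix_apply, h]

theorem mem_q {K : ℕ} {X : Mat K} : X ∈ q K ↔ ∀ i j, X i.opp j.opp = X i j :=
  ⟨fun h i j => congrFun (congrFun h i) j, fun h => by ext i j; exact h i j⟩

/-- A matrix is homogeneous of degree `d` if it is a combination of matrix units `E_{ij}` with
`deg i + deg j = d`. -/
def IsHomog {K : ℕ} (d : ZMod 2) (X : Mat K) : Prop :=
  ∀ i j, X i j ≠ 0 → i.2 + j.2 = d

/-- The Lie superalgebra bracket `x y - (-1) ^ (a b) y x` of elements `x`, `y` of `𝔮_K` which are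
homogeneous of degrees `a`, `b`. -/
noncomputable def bracket {K : ℕ} (a b : ZMod 2) (x y : q K) : q K :=
  x * y - sgn (a * b) • (y * x)

/-- The defining relations `x y - (-1) ^ (deg x deg y) y x = [x, y]` of the enveloping algebra, where
`x`, `y` run through the homogeneous elements of `𝔮_K`. -/
inductive Rel (K : ℕ) : TensorAlgebra ℂ (q K) → TensorAlgebra ℂ (q K) → Prop
  | mk (a b : ZMod 2) (x y : q K) (hx : IsHomog a (x : Mat K)) (hy : IsHomog b (y : Mat K)) :
      Rel K
        (TensorAlgebra.ι ℂ x * TensorAlgebra.ι ℂ y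
          - sgn (a * b) • (TensorAlgebra.ι ℂ y * TensorAlgebra.ι ℂ x))
        (TensorAlgebra.ι ℂ (bracket a b x y))

/-- The universal enveloping algebra `U(𝔮_K)` of the Lie superalgebra `𝔮_K`. -/
abbrev U (K : ℕ) : Type := RingQuot (Rel K)

/-- The canonical map from `𝔮_K` to `U(𝔮_K)`. -/
noncomputable def ofQ (K : ℕ) : q K →ₗ[ℂ] U K :=
  (RingQuot.mkAlgHom ℂ (Rel K)).toLinearMap ∘ₗ TensorAlgebra.ι ℂ

theorem ofQ_rel {K : ℕ} (a b : ZMod 2) (x y : q K) (hx : IsHomog a (x : Mat K))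
    (hy : IsHomog b (y : Mat K)) :
    ofQ K x * ofQ K y - sgn (a * b) • (ofQ K y * ofQ K x) = ofQ K (bracket a b x y) := by
  have h := RingQuot.mkAlgHom_rel ℂ (Rel.mk a b x y hx hy)
  simpa [ofQ] using h

/-- Universal property of `U(𝔮_K)`: a linear map from `𝔮_K` to an associative algebra compatible with
the bracket extends to `U(𝔮_K)`. -/
noncomputable def liftU {K : ℕ} {A : Type} [Ring A] [Algebra ℂ A] (f : q K →ₗ[ℂ] A)
    (hf : ∀ (a b : ZMod 2) (x y : q K), IsHomog a (x : Mat K) → IsHomog b (y : Mat K) →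
      f x * f y - sgn (a * b) • (f y * f x) = f (bracket a b x y)) : U K →ₐ[ℂ] A :=
  RingQuot.liftAlgHom ℂ ⟨TensorAlgebra.lift ℂ f, by
    rintro _ _ ⟨a, b, x, y, hx, hy⟩
    simpa using hf a b x y hx hy⟩

theorem liftU_ofQ {K : ℕ} {A : Type} [Ring A] [Algebra ℂ A] (f : q K →ₗ[ℂ] A)
    (hf : ∀ (a b : ZMod 2) (x y : q K), IsHomog a (x : Mat K) → IsHomog b (y : Mat K) →
      f x * f y - sgn (a * b) • (f y * f x) = f (bracket a b x y)) (x : q K) :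
    liftU f hf (ofQ K x) = f x := by
  simp [liftU, ofQ]

theorem IsHomog.mul {K : ℕ} {a b : ZMod 2} {X Y : Mat K} (hX : IsHomog a X) (hY : IsHomog b Y) :
    IsHomog (a + b) (X * Y) := by
  intro i j hij
  rw [Matrix.mul_apply] at hij
  obtain ⟨k, -, hk⟩ := Finset.exists_ne_zero_of_sum_ne_zero hij
  rw [← hX i k (left_ne_zero_of_mul hk), ← hY k j (right_ne_zero_of_mul hk)]
  have h : ∀ u v w : ZMod 2, u + w = u + v + (v + w) := by decide
  exact h _ _ _

theorem IsHomog.bracket {K : ℕ} {a b : ZMod 2} {x y : q K} (hx : IsHomog a (x : Mat K))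
    (hy : IsHomog b (y : Mat K)) : IsHomog (a + b) (bracket a b x y : Mat K) := by
  intro i j hij
  by_cases h : ((x : Mat K) * (y : Mat K)) i j = 0
  · have h2 : ((y : Mat K) * (x : Mat K)) i j ≠ 0 := by
      intro h2
      apply hij
      simp [QueerLie.bracket, h, h2]
    rw [add_comm a b]
    exact hy.mul hx i j h2
  · exact hx.mul hy i j h

/-- The linear map on `𝔮_K` acting as `(-1) ^ d` on elements of degree `d`. -/
noncomputable def parityQ (K : ℕ) : q K →ₗ[ℂ] q K where
  toFun x := ⟨Matrix.of fun i j => sgn (i.2 + j.2) * (x : Mat K) i j, by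
    rw [mem_q]
    intro i j
    have h : ∀ u v : ZMod 2, u + 1 + (v + 1) = u + v := by decide
    simp only [Matrix.of_apply, mem_q.1 x.2 i j]
    simp [Idx.opp, h]⟩
  map_add' x y := by
    ext i j
    simp [mul_add]
  map_smul' c x := by
    ext i j
    simp [mul_left_comm]

theorem parityQ_of_isHomog {K : ℕ} {d : ZMod 2} {x : q K} (hx : IsHomog d (x : Mat K)) :
    parityQ K x = sgn d • x := by
  ext i j
  by_cases h : (x : Mat K) i j = 0
  · simp [parityQ, h]
  · simp [parityQ, hx i j h]

/-- The automorphism of `U(𝔮_K)` acting as `(-1) ^ d` on elements of degree `d`; the `ℤ / 2`-gradation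
of `U(𝔮_K)` is the decomposition into its eigenspaces. -/
noncomputable def parityU (K : ℕ) : U K →ₐ[ℂ] U K :=
  liftU (ofQ K ∘ₗ parityQ K) (by
    intro a b x y hx hy
    simp only [LinearMap.comp_apply, parityQ_of_isHomog hx, parityQ_of_isHomog hy,
      parityQ_of_isHomog (hx.bracket hy), map_smul, ← ofQ_rel a b x y hx hy]
    simp only [smul_mul_assoc, mul_smul_comm, smul_sub, smul_smul, sgn_add]
    congr 2 <;> ring)

/-- The homogeneous component of degree `d` of an element of `U(𝔮_K)`. -/
noncomputable def comp {K : ℕ} (d : ZMod 2) (X : U K) : U K :=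
  (1 / 2 : ℂ) • (X + sgn d • parityU K X)

/-- The supercommutator, equal to `X Y - (-1) ^ (deg X deg Y) Y X` for homogeneous `X`, `Y` and
extended by bilinearity to all elements of `U(𝔮_K)`. -/
noncomputable def superComm {K : ℕ} (X Y : U K) : U K :=
  ∑ a : ZMod 2, ∑ b : ZMod 2, (comp a X * comp b Y - sgn (a * b) • (comp b Y * comp a X))

/-- The element `F_{ij} = E_{ij} + E_{-i,-j}` of `𝔮_K`. -/
noncomputable def Fmat {K : ℕ} (i j : Idx K) : q K :=
  ⟨Matrix.single i j 1 + Matrix.single i.opp j.opp 1, by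
    rw [mem_q]
    intro k l
    have h : ∀ u v : Idx K, u.opp = v.opp ↔ u = v := fun u v => (oppEquiv K).injective.eq_iff
    have h' : ∀ u v : Idx K, u = v.opp ↔ u.opp = v := fun u v =>
      ⟨fun e => by rw [e, opp_opp], fun e => by rw [← e, opp_opp]⟩
    simp only [Matrix.add_apply, Matrix.single_apply, h, h']
    rw [add_comm]⟩

/-- The element `F_{ij}` of `U(𝔮_K)`. -/
noncomputable def F {K : ℕ} (i j : Idx K) : U K := ofQ K (Fmat i j)

/-- For `n ≥ 1`, the element `F_{ij|K}^{(n)}` of `U(𝔮_K)`: the sum over all `k_1, …, k_{n-1}` of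
`(-1) ^ (deg k_1 + … + deg k_{n-1}) F_{k_0 k_1} F_{k_1 k_2} … F_{k_{n-1} k_n}` where `k_0 = i` and
`k_n = j`. (The value at `n = 0` is not used.) -/
noncomputable def Fn (K : ℕ) : ℕ → Idx K → Idx K → U K
  | 0, _, _ => 0
  | m + 1, i, j =>
    ∑ k : Fin m → Idx K,
      sgn (∑ t, (k t).2) •
        (List.ofFn fun t : Fin (m + 1) =>
          F ((Fin.cons i k : Fin (m + 1) → Idx K) t)
            ((Fin.snoc k j : Fin (m + 1) → Idx K) t)).prod

/-- For `n ≥ 1`, the element `C_K^{(n)}` of `U(𝔮_K)`. -/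
noncomputable def Cn (K n : ℕ) : U K := ∑ k : Idx K, Fn K n k k

/-- The matrix of the inclusion of `ℂ^{K|K}` into `ℂ^{L|L}`, where `K ≤ L`. -/
def inclMat {K L : ℕ} (h : K ≤ L) : Matrix (Idx L) (Idx K) ℂ :=
  Matrix.of fun i k => if i = k.cast h then 1 else 0

theorem cast_injective {K L : ℕ} (h : K ≤ L) : Function.Injective (Idx.cast h) := by
  intro i j hij
  simp only [Idx.cast, Prod.mk.injEq] at hij
  exact Prod.ext (Fin.castLE_injective h hij.1) hij.2

theorem inclMat_transpose_mul {K L : ℕ} (h : K ≤ L) :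
    (inclMat h).transpose * inclMat h = 1 := by
  ext i j
  simp [Matrix.mul_apply, inclMat, Matrix.one_apply, (cast_injective h).eq_iff, eq_comm]

/-- The inclusion of `𝔮_K` into `𝔮_L`, where `K ≤ L`: extension of matrices by zero. -/
noncomputable def inclQ {K L : ℕ} (h : K ≤ L) : q K →ₗ[ℂ] q L where
  toFun x := ⟨inclMat h * (x : Mat K) * (inclMat h).transpose, by
    have key : ∀ (i : Idx L) (k : Idx K), inclMat h i.opp k.opp = inclMat h i k := by
      intro i k
      have e : k.opp.cast h = (k.cast h).opp := rfl
      have e2 : i.opp = (k.cast h).opp ↔ i = k.cast h := (oppEquiv L).injective.eq_iff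
      simp [inclMat, e, e2]
    rw [mem_q]
    intro i j
    simp only [Matrix.mul_apply, Matrix.transpose_apply]
    rw [← (oppEquiv K).sum_comp]
    refine Finset.sum_congr rfl fun l _ => ?_
    have e1 : inclMat h j.opp (oppEquiv K l) = inclMat h j l := key j l
    rw [e1, ← (oppEquiv K).sum_comp]
    congr 1
    refine Finset.sum_congr rfl fun k _ => ?_
    have e3 : inclMat h i.opp (oppEquiv K k) = inclMat h i k := key i k
    have e4 : (x : Mat K) (oppEquiv K k) (oppEquiv K l) = (x : Mat K) k l := mem_q.1 x.2 k l
    rw [e3, e4]⟩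
  map_add' x y := by
    ext1
    simp [Matrix.mul_add, Matrix.add_mul]
  map_smul' c x := by
    ext1
    simp

theorem inclQ_mul {K L : ℕ} (h : K ≤ L) (x y : q K) : inclQ h (x * y) = inclQ h x * inclQ h y := by
  ext1
  change inclMat h * ((x : Mat K) * (y : Mat K)) * (inclMat h).transpose
    = inclMat h * (x : Mat K) * (inclMat h).transpose
      * (inclMat h * (y : Mat K) * (inclMat h).transpose)
  calc inclMat h * ((x : Mat K) * (y : Mat K)) * (inclMat h).transpose
      = inclMat h * (x : Mat K) * ((inclMat h).transpose * inclMat h) * (y : Mat K)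
          * (inclMat h).transpose := by
        rw [inclMat_transpose_mul]; simp only [Matrix.mul_one, Matrix.mul_assoc]
    _ = _ := by simp only [Matrix.mul_assoc]

theorem IsHomog.inclQ {K L : ℕ} (h : K ≤ L) {d : ZMod 2} {x : q K} (hx : IsHomog d (x : Mat K)) :
    IsHomog d (inclQ h x : Mat L) := by
  intro i j hij
  change (inclMat h * (x : Mat K) * (inclMat h).transpose) i j ≠ 0 at hij
  rw [Matrix.mul_apply] at hij
  obtain ⟨l, -, hl⟩ := Finset.exists_ne_zero_of_sum_ne_zero hij
  have h1 := left_ne_zero_of_mul hl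
  rw [Matrix.mul_apply] at h1
  obtain ⟨k, -, hk⟩ := Finset.exists_ne_zero_of_sum_ne_zero h1
  have h2 : i = k.cast h := by
    by_contra hne
    exact left_ne_zero_of_mul hk (by simp [inclMat, hne])
  have h3 : j = l.cast h := by
    by_contra hne
    exact right_ne_zero_of_mul hl (by simp [inclMat, hne])
  rw [h2, h3]
  exact hx k l (right_ne_zero_of_mul hk)

/-- The canonical homomorphism `U(𝔮_K) → U(𝔮_L)` extending the inclusion of `𝔮_K` into `𝔮_L`, where
`K ≤ L`. -/
noncomputable def inclU {K L : ℕ} (h : K ≤ L) : U K →ₐ[ℂ] U L :=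
  liftU (ofQ L ∘ₗ inclQ h) (by
    intro a b x y hx hy
    have e : inclQ h (bracket a b x y) = bracket a b (inclQ h x) (inclQ h y) := by
      simp only [bracket, map_sub, map_smul, inclQ_mul]
    simp only [LinearMap.comp_apply, e]
    exact ofQ_rel a b _ _ (hx.inclQ h) (hy.inclQ h))

/-- The subspace of `𝔮_{N+M} ⊆ U(𝔮_{N+M})` spanned by the elements `F_{ij}` with `|i|, |j| > N`; this
is the copy of `𝔮_M` in `𝔮_{N+M}`. -/
noncomputable def qTail (N M : ℕ) : Submodule ℂ (U (N + M)) :=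
  Submodule.span ℂ {Y | ∃ i j : Idx (N + M), N < i.abs ∧ N < j.abs ∧ Y = F i j}

theorem superComm_add_right {K : ℕ} (X Y Z : U K) :
    superComm X (Y + Z) = superComm X Y + superComm X Z := by
  simp only [superComm, ← Finset.sum_add_distrib]
  refine Finset.sum_congr rfl fun a _ => Finset.sum_congr rfl fun b _ => ?_
  have e : comp b (Y + Z) = comp b Y + comp b Z := by
    simp only [comp, map_add, ← smul_add]
    congr 1
    rw [smul_add]
    abel
  rw [e, mul_add, add_mul, smul_add]
  abel

theorem superComm_smul_right {K : ℕ} (c : ℂ) (X Y : U K) :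
    superComm X (c • Y) = c • superComm X Y := by
  simp only [superComm, Finset.smul_sum]
  refine Finset.sum_congr rfl fun a _ => Finset.sum_congr rfl fun b _ => ?_
  have e : comp b (c • Y) = c • comp b Y := by
    simp only [comp, map_smul, smul_add, smul_smul]
    congr 2 <;> ring
  simp only [e, mul_smul_comm, smul_mul_assoc, smul_sub, smul_smul]
  congr 2
  ring

theorem superComm_of_homog {K : ℕ} (d : ZMod 2) (X Y : U K) (hY : parityU K Y = sgn d • Y) :
    superComm X Y = X * Y - Y * (if d = 0 then X else parityU K X) := by
  have hz : (Finset.univ : Finset (ZMod 2)) = {0, 1} := by decide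
  have h01 : (0 : ZMod 2) ∉ ({1} : Finset (ZMod 2)) := by decide
  have hX : X = comp 0 X + comp 1 X := by
    simp only [comp, sgn_zero, sgn_one, one_smul]
    module
  have hX' : parityU K X = comp 0 X - comp 1 X := by
    simp only [comp, sgn_zero, sgn_one, one_smul]
    module
  simp only [superComm, hz, Finset.sum_insert h01, Finset.sum_singleton, mul_zero, mul_one,
    sgn_zero, sgn_one]
  rcases zmod_two_cases d with rfl | rfl
  · have h0 : comp 0 Y = Y := by
      simp only [comp, hY, sgn_zero]
      module
    have h1 : comp 1 Y = 0 := by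
      simp only [comp, hY, sgn_zero, sgn_one]
      module
    rw [h0, h1, if_pos rfl]
    have e1 : X * Y = comp 0 X * Y + comp 1 X * Y := by rw [← add_mul, ← hX]
    have e2 : Y * X = Y * comp 0 X + Y * comp 1 X := by rw [← mul_add, ← hX]
    rw [e1, e2]
    simp only [mul_zero, zero_mul, smul_zero]
    module
  · have h0 : comp 0 Y = 0 := by
      simp only [comp, hY, sgn_zero, sgn_one]
      module
    have h1 : comp 1 Y = Y := by
      simp only [comp, hY, sgn_one]
      module
    rw [h0, h1, if_neg (by decide), hX']
    have e1 : X * Y = comp 0 X * Y + comp 1 X * Y := by rw [← add_mul, ← hX]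
    rw [e1]
    simp only [mul_zero, zero_mul, mul_sub, smul_zero]
    module

theorem isHomog_Fmat {K : ℕ} (i j : Idx K) : IsHomog (i.2 + j.2) (Fmat i j : Mat K) := by
  intro k l hkl
  have h : ∀ u v : ZMod 2, u + 1 + (v + 1) = u + v := by decide
  by_cases h1 : i = k ∧ j = l
  · rw [h1.1, h1.2]
  · by_cases h2 : i.opp = k ∧ j.opp = l
    · rw [← h2.1, ← h2.2]
      exact h _ _
    · exact absurd (by simp [Fmat, h1, h2]) hkl

theorem parityU_F {K : ℕ} (i j : Idx K) : parityU K (F i j) = sgn (i.2 + j.2) • F i j := by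
  rw [parityU, F, liftU_ofQ, LinearMap.comp_apply, parityQ_of_isHomog (isHomog_Fmat i j), map_smul]

theorem superComm_qTail_iff {N M : ℕ} (X : U (N + M)) :
    (∀ Y ∈ qTail N M, superComm X Y = 0) ↔
      ∀ i j : Idx (N + M), N < i.abs → N < j.abs →
        X * F i j = F i j * (if i.2 + j.2 = 0 then X else parityU (N + M) X) := by
  constructor
  · intro h i j hi hj
    have h1 := h (F i j) (Submodule.subset_span ⟨i, j, hi, hj, rfl⟩)
    rwa [superComm_of_homog _ _ _ (parityU_F i j), sub_eq_zero] at h1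
  · intro h Y hY
    induction hY using Submodule.span_induction with
    | mem Y hY =>
      obtain ⟨i, j, hi, hj, rfl⟩ := hY
      rw [superComm_of_homog _ _ _ (parityU_F i j), sub_eq_zero]
      exact h i j hi hj
    | zero => simpa using superComm_smul_right 0 X 0
    | add Y Z _ _ hY hZ => rw [superComm_add_right, hY, hZ, add_zero]
    | smul c Y _ hY => rw [superComm_smul_right, hY, smul_zero]

/-- The algebra `A_N^M`: the centralizer of `𝔮_M` in the associative superalgebra `U(𝔮_{N+M})`, that
is the set of all `X` with vanishing supercommutator `[X, Y]` for every `Y ∈ 𝔮_M`. -/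
noncomputable def A (N M : ℕ) : Subalgebra ℂ (U (N + M)) where
  carrier := {X | ∀ Y ∈ qTail N M, superComm X Y = 0}
  mul_mem' {X Y} hX hY := by
    simp only [Set.mem_ofPred_eq, superComm_qTail_iff] at hX hY ⊢
    intro i j hi hj
    rw [mul_assoc, hY i j hi hj, ← mul_assoc, hX i j hi hj, mul_assoc]
    split_ifs
    · rfl
    · rw [map_mul]
  add_mem' {X Y} hX hY := by
    simp only [Set.mem_ofPred_eq, superComm_qTail_iff] at hX hY ⊢
    intro i j hi hj
    rw [add_mul, hX i j hi hj, hY i j hi hj, ← mul_add]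
    split_ifs
    · rfl
    · rw [map_add]
  algebraMap_mem' r := by
    simp only [Set.mem_ofPred_eq, superComm_qTail_iff]
    intro i j _ _
    rw [AlgHom.commutes, ite_self]
    exact Algebra.commutes r _

/-- The right ideal `I_L` of `U(𝔮_L)` generated by the elements `F_{L,±1}, …, F_{L,±L}`. -/
noncomputable def I (L : ℕ) : Submodule (U L)ᵐᵒᵖ (U L) :=
  Submodule.span (U L)ᵐᵒᵖ {Y | ∃ i j : Idx L, i.abs = L ∧ i.2 = 0 ∧ Y = F i j}

end QueerLie

/-! Put L = N + M, K = L - 1, and let e (`cut`) be the even idempotent of 𝔮_L projecting onto the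
indices of absolute value at most K. As a vector space 𝔮_L is the direct sum of its subalgebras e𝔮_L
and (1 - e)𝔮_L; the latter is spanned by the F_{±L,j}, and I_L is the right ideal it generates. One
therefore expects U(𝔮_L)/I_L to be U(e𝔮_L). Instead of invoking a PBW theorem, the proof builds the
right action of 𝔮_L on U(e𝔮_L) by hand: `rho_mul` says how it must move past a last factor, and
`rho_bracket` verifies that it is an action. The unit is killed by (1 - e)𝔮_L, hence by I_L.
Deleting the columns ±L is a homomorphism from e𝔮_L to 𝔮_K, so acting on 1 and then deleting columns
gives a linear map `retract` which vanishes on I_L and is a left inverse of `inclU`. This yields the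
first claim, and the uniqueness of α(X).

For existence, modulo I_L the algebra U(𝔮_L) is spanned by products Z F_{i_1 L} ⋯ F_{i_d L} with Z
from U(𝔮_K) and |i_t| ≤ K (`iSup_weightSpace`), and right multiplication by F_{LL} acts on them as
the scalar d (`weightSpace_weight`). As M ≥ 1, an element X of A_N^M commutes with F_{LL}, so X
F_{LL} = F_{LL} X lies in I_L: X has weight 0 and lies in U(𝔮_K) + I_L. Left multiplication by
U(𝔮_K) preserves I_L (`inclU_mul_mem_I`), which makes α multiplicative and, together with the first
claim, puts α(X) in A_N^{M-1}.

The elements F^{(n)}_{ij} obey the same commutation rule with F_{kl} as the F_{ij} do (`F_mul_Fn`).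
This gives membership in A_N^M. It also shows that in the recursion for F^{(n)} the summation
indices L and -L give congruent terms with opposite signs, which cancel modulo I_L. -/

namespace QueerLie

open scoped BigOperators

/-! ### Generation of algebras given by generators and relations -/

section Generation

/-- A linear family of endomorphisms, regarded as acting from the right. -/
def opLin {W V : Type} [AddCommGroup W] [Module ℂ W] [AddCommGroup V] [Module ℂ V]
    (f : W →ₗ[ℂ] Module.End ℂ V) : W →ₗ[ℂ] (Module.End ℂ V)ᵐᵒᵖ where
  toFun x := MulOpposite.op (f x)
  map_add' x y := by rw [map_add, MulOpposite.op_add]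
  map_smul' c x := by rw [map_smul, MulOpposite.op_smul]; rfl

variable {W : Type} [AddCommGroup W] [Module ℂ W]

theorem ringQuot_subalgebra_eq_top {r : TensorAlgebra ℂ W → TensorAlgebra ℂ W → Prop}
    (S : Subalgebra ℂ (RingQuot r))
    (h : ∀ x, RingQuot.mkAlgHom ℂ r (TensorAlgebra.ι ℂ x) ∈ S) : ∀ u, u ∈ S := by
  intro u
  obtain ⟨t, rfl⟩ := RingQuot.mkAlgHom_surjective ℂ r u
  induction t using TensorAlgebra.induction with
  | algebraMap c => rw [AlgHom.commutes]; exact S.algebraMap_mem c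
  | ι x => exact h x
  | mul a b ha hb => rw [map_mul]; exact S.mul_mem ha hb
  | add a b ha hb => rw [map_add]; exact S.add_mem ha hb

/-- A subspace of an algebra presented by generators and relations which contains `1` and is stable
under the right multiplication by the generators is the whole algebra. -/
theorem ringQuot_submodule_eq_top {r : TensorAlgebra ℂ W → TensorAlgebra ℂ W → Prop}
    (S : Submodule ℂ (RingQuot r)) (h1 : 1 ∈ S)
    (h : ∀ u ∈ S, ∀ x, u * RingQuot.mkAlgHom ℂ r (TensorAlgebra.ι ℂ x) ∈ S) : ∀ u, u ∈ S := by
  -- The elements v with S v ⊆ S form a subalgebra containing the generators, so it is everything;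
  -- then apply it to 1 ∈ S.
  let T : Subalgebra ℂ (RingQuot r) :=
    { carrier := {v | ∀ u ∈ S, u * v ∈ S}
      mul_mem' := fun {v w} hv hw u hu => by
        rw [← mul_assoc]; exact hw _ (hv u hu)
      add_mem' := fun {v w} hv hw u hu => by
        rw [mul_add]; exact S.add_mem (hv u hu) (hw u hu)
      algebraMap_mem' := fun c u hu => by
        rw [← Algebra.commutes, ← Algebra.smul_def]; exact S.smul_mem c hu }
  intro u
  have := ringQuot_subalgebra_eq_top T (fun x v hv => h v hv x) u 1 h1
  rwa [one_mul] at this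

end Generation

/-! ### Parity twists, homogeneous parts and the super adjoint action on 𝔮_L -/

section Twist

variable {L : ℕ}

theorem isHomog_one : IsHomog 0 (1 : Mat L) := by
  intro i j hij
  have h : i = j := by
    by_contra h
    exact hij (by simp [h])
  have h2 : ∀ u : ZMod 2, u + u = 0 := by decide
  rw [h, h2]

theorem parityQ_mul (x y : q L) : parityQ L (x * y) = parityQ L x * parityQ L y := by
  ext i j
  have h : ∀ k : Idx L, sgn (i.2 + j.2) = sgn (i.2 + k.2) * sgn (k.2 + j.2) := by
    intro k
    have h2 : ∀ u v w : ZMod 2, u + w = u + v + (v + w) := by decide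
    rw [← sgn_add, ← h2]
  simp only [parityQ, LinearMap.coe_mk, AddHom.coe_mk, MulMemClass.coe_mul, Matrix.of_apply,
    Matrix.mul_apply, Finset.mul_sum]
  refine Finset.sum_congr rfl fun k _ => ?_
  rw [h k]
  ring

theorem parityQ_parityQ (x : q L) : parityQ L (parityQ L x) = x := by
  ext i j
  simp [parityQ, ← mul_assoc, sgn_mul_self]

/-- The power of the parity automorphism of `𝔮_L` with exponent in `ℤ / 2`. -/
noncomputable def twist (a : ZMod 2) : q L →ₗ[ℂ] q L := if a = 0 then LinearMap.id else parityQ L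

theorem twist_zero (x : q L) : twist 0 x = x := by simp [twist]

theorem twist_one (x : q L) : twist 1 x = parityQ L x := by simp [twist]

theorem twist_mul (a : ZMod 2) (x y : q L) : twist a (x * y) = twist a x * twist a y := by
  rcases zmod_two_cases a with rfl | rfl
  · simp only [twist_zero]
  · simp only [twist_one, parityQ_mul]

theorem twist_twist (a b : ZMod 2) (x : q L) : twist a (twist b x) = twist (a + b) x := by
  have h : (1 : ZMod 2) + 1 = 0 := by decide
  rcases zmod_two_cases a with rfl | rfl <;> rcases zmod_two_cases b with rfl | rfl <;>
    simp [twist_zero, twist_one, h, parityQ_parityQ]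

theorem twist_of_isHomog (a : ZMod 2) {d : ZMod 2} {x : q L} (hx : IsHomog d (x : Mat L)) :
    twist a x = sgn (a * d) • x := by
  rcases zmod_two_cases a with rfl | rfl
  · simp [twist_zero, sgn_zero]
  · rw [twist_one, parityQ_of_isHomog hx, one_mul]

/-- The component of degree `a` of an element of `𝔮_L`. -/
noncomputable def part (a : ZMod 2) : q L →ₗ[ℂ] q L :=
  (1 / 2 : ℂ) • (LinearMap.id + sgn a • parityQ L)

theorem isHomog_part (a : ZMod 2) (x : q L) : IsHomog a (part a x : Mat L) := by
  intro i j hij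
  by_contra hne
  apply hij
  have h : ∀ a d : ZMod 2, d ≠ a → d = a + 1 := by decide
  have h1 := h _ _ hne
  simp only [part, LinearMap.smul_apply, LinearMap.add_apply, LinearMap.id_apply]
  change (1 / 2 : ℂ) * ((x : Mat L) i j + sgn a * (sgn (i.2 + j.2) * (x : Mat L) i j)) = 0
  rw [h1, sgn_add, ← mul_assoc, ← mul_assoc, sgn_mul_self, sgn_one]
  ring

theorem part_add_part (x : q L) : part 0 x + part 1 x = x := by
  simp only [part, LinearMap.smul_apply, LinearMap.add_apply, LinearMap.id_apply, sgn_zero, sgn_one]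
  module

theorem part_of_isHomog (a : ZMod 2) {d : ZMod 2} {x : q L} (hx : IsHomog d (x : Mat L)) :
    part a x = if a = d then x else 0 := by
  simp only [part, LinearMap.smul_apply, LinearMap.add_apply, LinearMap.id_apply,
    parityQ_of_isHomog hx]
  rcases zmod_two_cases a with rfl | rfl <;> rcases zmod_two_cases d with rfl | rfl <;>
    simp [sgn_zero, sgn_one]
  all_goals module

/-- For `z` homogeneous of degree `a`, the map `y ↦ [z, y]`. -/
noncomputable def superAd (a : ZMod 2) (z : q L) : q L →ₗ[ℂ] q L :=
  LinearMap.mulLeft ℂ z - LinearMap.mulRight ℂ z ∘ₗ twist a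

theorem superAd_apply (a : ZMod 2) (z y : q L) : superAd a z y = z * y - twist a y * z := rfl

theorem superAd_add_left (a : ZMod 2) (z z' y : q L) :
    superAd a (z + z') y = superAd a z y + superAd a z' y := by
  simp only [superAd_apply, add_mul, mul_add]; abel

theorem superAd_smul_left (a : ZMod 2) (c : ℂ) (z y : q L) :
    superAd a (c • z) y = c • superAd a z y := by
  simp only [superAd_apply, smul_mul_assoc, mul_smul_comm, smul_sub]

theorem superAd_of_isHomog (a : ZMod 2) {d : ZMod 2} (z : q L) {y : q L}
    (hy : IsHomog d (y : Mat L)) : superAd a z y = bracket a d z y := by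
  rw [superAd_apply, bracket, twist_of_isHomog a hy, smul_mul_assoc]

/-- Twisting is multiplicative, so the only effect is the sign picked up by x. -/
theorem twist_superAd (a b : ZMod 2) {x : q L} (hx : IsHomog a (x : Mat L)) (y : q L) :
    twist b (superAd a x y) = sgn (a * b) • superAd a x (twist b y) := by
  rw [superAd_apply, superAd_apply, map_sub, twist_mul, twist_mul, twist_of_isHomog b hx,
    twist_twist, twist_twist, add_comm b a, mul_comm b a, smul_mul_assoc, mul_smul_comm, smul_sub]

/-- The super Jacobi identity. -/
theorem superAd_bracket (a b : ZMod 2) {x y : q L} (hx : IsHomog a (x : Mat L))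
    (hy : IsHomog b (y : Mat L)) (w : q L) :
    superAd (a + b) (bracket a b x y) w
      = superAd a x (superAd b y w) - sgn (a * b) • superAd b y (superAd a x w) := by
  simp only [superAd_apply, bracket, map_sub, twist_mul, twist_of_isHomog a hy,
    twist_of_isHomog b hx, twist_twist, mul_comm b a, add_comm b a, mul_sub, sub_mul, smul_sub,
    smul_mul_assoc, mul_smul_comm, smul_smul, sgn_mul_self, one_smul, mul_assoc]
  abel

end Twist

/-! ### The Jacobi identity in derivation form -/

section Jacobi

variable {L : ℕ}

theorem sgn_eq_or (p : ZMod 2) : sgn p = 1 ∨ sgn p = -1 := by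
  rcases zmod_two_cases p with rfl | rfl
  · exact Or.inl sgn_zero
  · exact Or.inr sgn_one

/-- Bracketing with z on the left is a superderivation. This form serves the induction in
`rho_bracket`, where z is the last factor split off. The signs are settled by the eight values of
the three products of degrees. -/
theorem jacobi (a b c : ZMod 2) (x y z : q L) :
    bracket c (a + b) z (bracket a b x y)
      = sgn (c * a) • bracket a (c + b) x (bracket c b z y)
        + bracket (c + a) b (bracket c a z x) y := by
  simp only [bracket, add_mul, mul_add, sgn_add, mul_comm a c]
  rcases sgn_eq_or (a * b) with h1 | h1 <;> rcases sgn_eq_or (c * a) with h2 | h2 <;>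
    rcases sgn_eq_or (c * b) with h3 | h3 <;>
    simp only [h1, h2, h3, smul_sub, one_smul, neg_smul, neg_neg, mul_neg, mul_one,
      sub_mul, mul_sub, mul_assoc, sub_neg_eq_add, mul_add, add_mul,
      smul_add] <;> abel

end Jacobi

/-! ### The induced right module U(e𝔮_L), built without PBW -/

section Parabolic

variable {L : ℕ}

/-- The relations of the enveloping algebra of the subalgebra `e 𝔮_L ⊆ 𝔮_L`, where `e` is an even
idempotent. The generators are the elements of `𝔮_L`, those of `(1 - e) 𝔮_L` being zero. -/
inductive RelP (e : q L) : TensorAlgebra ℂ (q L) → TensorAlgebra ℂ (q L) → Prop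
  | mk (a b : ZMod 2) (x y : q L) (hx : IsHomog a (x : Mat L)) (hy : IsHomog b (y : Mat L))
      (hex : e * x = x) (hey : e * y = y) :
      RelP e
        (TensorAlgebra.ι ℂ x * TensorAlgebra.ι ℂ y
          - sgn (a * b) • (TensorAlgebra.ι ℂ y * TensorAlgebra.ι ℂ x))
        (TensorAlgebra.ι ℂ (bracket a b x y))
  | kill (x : q L) (hex : e * x = 0) : RelP e (TensorAlgebra.ι ℂ x) 0

/-- The enveloping algebra of the subalgebra `e 𝔮_L` of `𝔮_L`. -/
def UP (e : q L) : Type := RingQuot (RelP e)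

noncomputable instance (e : q L) : Ring (UP e) := inferInstanceAs (Ring (RingQuot (RelP e)))

noncomputable instance (e : q L) : Algebra ℂ (UP e) :=
  inferInstanceAs (Algebra ℂ (RingQuot (RelP e)))

/-- The projection of the tensor algebra onto the enveloping algebra of `e 𝔮_L`. -/
noncomputable def mkP (e : q L) : TensorAlgebra ℂ (q L) →ₐ[ℂ] UP e :=
  RingQuot.mkAlgHom ℂ (RelP e)

/-- The projection `𝔮_L → e 𝔮_L` followed by the canonical map to the enveloping algebra. -/
noncomputable def ofP (e : q L) : q L →ₗ[ℂ] UP e :=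
  (mkP e).toLinearMap ∘ₗ TensorAlgebra.ι ℂ

theorem ofP_rel {e : q L} (a b : ZMod 2) {x y : q L} (hx : IsHomog a (x : Mat L))
    (hy : IsHomog b (y : Mat L)) (hex : e * x = x) (hey : e * y = y) :
    ofP e x * ofP e y - sgn (a * b) • (ofP e y * ofP e x) = ofP e (bracket a b x y) := by
  have h : mkP e _ = mkP e _ := RingQuot.mkAlgHom_rel ℂ (RelP.mk a b x y hx hy hex hey)
  simpa [ofP] using h

theorem ofP_kill {e : q L} {x : q L} (hex : e * x = 0) : ofP e x = 0 := by
  have h : mkP e _ = mkP e _ := RingQuot.mkAlgHom_rel ℂ (RelP.kill x hex)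
  simpa [ofP] using h

theorem ofP_proj {e : q L} (he : e * e = e) (x : q L) : ofP e (e * x) = ofP e x := by
  rw [← sub_eq_zero, ← map_sub]
  exact ofP_kill (by rw [mul_sub, ← mul_assoc, he, sub_self])

/-- The universal property of the enveloping algebra of `e 𝔮_L`. -/
noncomputable def liftP {e : q L} {B : Type} [Ring B] [Algebra ℂ B] (f : q L →ₗ[ℂ] B)
    (hf : ∀ (a b : ZMod 2) (x y : q L), IsHomog a (x : Mat L) → IsHomog b (y : Mat L) →
      e * x = x → e * y = y → f x * f y - sgn (a * b) • (f y * f x) = f (bracket a b x y))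
    (hk : ∀ x, e * x = 0 → f x = 0) : UP e →ₐ[ℂ] B :=
  RingQuot.liftAlgHom ℂ (s := RelP e) ⟨TensorAlgebra.lift ℂ f, by
    rintro _ _ (⟨a, b, x, y, hx, hy, hex, hey⟩ | ⟨x, hex⟩)
    · simpa using hf a b x y hx hy hex hey
    · simpa using hk x hex⟩

theorem liftP_ofP {e : q L} {B : Type} [Ring B] [Algebra ℂ B] (f : q L →ₗ[ℂ] B)
    (hf : ∀ (a b : ZMod 2) (x y : q L), IsHomog a (x : Mat L) → IsHomog b (y : Mat L) →
      e * x = x → e * y = y → f x * f y - sgn (a * b) • (f y * f x) = f (bracket a b x y))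
    (hk : ∀ x, e * x = 0 → f x = 0) (x : q L) : liftP f hf hk (ofP e x) = f x := by
  have h := RingQuot.liftAlgHom_mkAlgHom_apply ℂ (TensorAlgebra.lift ℂ f)
    (s := RelP e) (by
      rintro _ _ (⟨a, b, x, y, hx, hy, hex, hey⟩ | ⟨x, hex⟩)
      · simpa using hf a b x y hx hy hex hey
      · simpa using hk x hex) (TensorAlgebra.ι ℂ x)
  rw [TensorAlgebra.lift_ι_apply] at h
  exact h

/-- A subspace of the enveloping algebra of `e 𝔮_L` which contains `1` and is stable under the right
multiplication by homogeneous elements of `e 𝔮_L` is the whole algebra. -/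
theorem UP_submodule_eq_top {e : q L} (he : e * e = e) (h0 : IsHomog 0 (e : Mat L))
    (S : Submodule ℂ (UP e)) (h1 : 1 ∈ S)
    (h : ∀ u ∈ S, ∀ (a : ZMod 2) (z : q L), IsHomog a (z : Mat L) → e * z = z →
      u * ofP e z ∈ S) : ∀ u, u ∈ S := by
  refine ringQuot_submodule_eq_top (r := RelP e) S h1 fun (u : UP e) hu x => ?_
  change u * ofP e x ∈ S
  -- An arbitrary generator is the image of its projection to e𝔮_L, which is the sum of its two
  -- homogeneous parts.
  rw [← ofP_proj he, ← part_add_part x, mul_add, map_add, mul_add]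
  have key : ∀ a, u * ofP e (e * part a x) ∈ S := fun a =>
    h u hu a _ (by simpa using h0.mul (isHomog_part a x)) (by rw [← mul_assoc, he])
  exact S.add_mem (key 0) (key 1)

/-- The right action of an element of `e 𝔮_L` on the space of linear maps from `𝔮_L` to the enveloping
algebra of `e 𝔮_L`, given by `(φ z)(y) = (-1) ^ (deg y deg z) φ(y) z + φ([z, y])`. -/
noncomputable def homAct (e : q L) : q L →ₗ[ℂ] (q L →ₗ[ℂ] UP e) →ₗ[ℂ] (q L →ₗ[ℂ] UP e) :=
  LinearMap.mk₂ ℂ (fun z φ => ∑ a : ZMod 2,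
      (LinearMap.mulRight ℂ (ofP e (part a (e * z))) ∘ₗ φ ∘ₗ twist a
        + φ ∘ₗ superAd a (part a (e * z))))
    (by
      intro z z' φ
      ext y
      simp only [LinearMap.sum_apply, LinearMap.add_apply, LinearMap.comp_apply,
        LinearMap.mulRight_apply, mul_add, map_add, superAd_add_left, ← Finset.sum_add_distrib]
      exact Finset.sum_congr rfl fun a _ => by abel)
    (by
      intro c z φ
      ext y
      simp only [LinearMap.sum_apply, LinearMap.add_apply, LinearMap.comp_apply,
        LinearMap.smul_apply, LinearMap.mulRight_apply, mul_smul_comm, map_smul, superAd_smul_left,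
        Finset.smul_sum, smul_add])
    (by
      intro z φ φ'
      ext y
      simp only [LinearMap.sum_apply, LinearMap.add_apply, LinearMap.comp_apply,
        LinearMap.mulRight_apply, add_mul, ← Finset.sum_add_distrib]
      exact Finset.sum_congr rfl fun a _ => by abel)
    (by
      intro c z φ
      ext y
      simp only [LinearMap.sum_apply, LinearMap.add_apply, LinearMap.comp_apply,
        LinearMap.smul_apply, LinearMap.mulRight_apply, smul_mul_assoc,
        Finset.smul_sum, smul_add])

/-- Projecting to e𝔮_L and splitting into parts only serves to make `homAct` linear in all of 𝔮_L;
for homogeneous z in e𝔮_L a single summand survives. -/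
theorem homAct_apply {e : q L} {a : ZMod 2} {z : q L} (hz : IsHomog a (z : Mat L))
    (hez : e * z = z) (φ : q L →ₗ[ℂ] UP e) (y : q L) :
    homAct e z φ y = φ (twist a y) * ofP e z + φ (superAd a z y) := by
  have h : ∀ b : ZMod 2, b ≠ a →
      (LinearMap.mulRight ℂ (ofP e (part b (e * z))) ∘ₗ φ ∘ₗ twist b
        + φ ∘ₗ superAd b (part b (e * z))) y = 0 := by
    intro b hb
    have h0 : superAd b (0 : q L) y = 0 := by simp [superAd_apply]
    rw [hez, part_of_isHomog b hz, if_neg hb]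
    simp [h0]
  have h2 : homAct e z φ y = ∑ b : ZMod 2,
      (LinearMap.mulRight ℂ (ofP e (part b (e * z))) ∘ₗ φ ∘ₗ twist b
        + φ ∘ₗ superAd b (part b (e * z))) y := by
    simp [homAct]
  rw [h2, Finset.sum_eq_single a (fun b _ hb => h b hb) (by simp), hez, part_of_isHomog a hz,
    if_pos rfl]
  simp

theorem homAct_kill {e : q L} {z : q L} (hez : e * z = 0) : homAct e z = 0 := by
  ext φ y
  have h0 : ∀ b, superAd b (0 : q L) y = 0 := by simp [superAd_apply]
  simp [homAct, hez, h0]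

theorem mul_bracket {e : q L} (a b : ZMod 2) {x y : q L} (hex : e * x = x) (hey : e * y = y) :
    e * bracket a b x y = bracket a b x y := by
  rw [bracket, mul_sub, mul_smul_comm, ← mul_assoc, ← mul_assoc, hex, hey]

/-- The linear map `homAct` with values in the opposite algebra. -/
noncomputable def homActOp (e : q L) : q L →ₗ[ℂ] (Module.End ℂ (q L →ₗ[ℂ] UP e))ᵐᵒᵖ :=
  opLin (V := q L →ₗ[ℂ] UP e) (homAct e)

theorem unop_homActOp (e z : q L) : (homActOp e z).unop = homAct e z := rfl

/-- In the supercommutator the mixed terms, with one factor multiplied on the right and the other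
inside φ, cancel. What is left is governed by the relations of `UP e` and by the Jacobi identity
`superAd_bracket`. -/
theorem homActOp_rel {e : q L} (a b : ZMod 2) (x y : q L) (hx : IsHomog a (x : Mat L))
    (hy : IsHomog b (y : Mat L)) (hex : e * x = x) (hey : e * y = y) :
    homActOp e x * homActOp e y - sgn (a * b) • (homActOp e y * homActOp e x)
      = homActOp e (bracket a b x y) := by
  refine MulOpposite.unop_injective (LinearMap.ext fun φ => LinearMap.ext fun w => ?_)
  have h1 : superAd a x (twist b w) = sgn (a * b) • twist b (superAd a x w) := by
    rw [twist_superAd a b hx, smul_smul, sgn_mul_self, one_smul]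
  simp only [MulOpposite.unop_sub, MulOpposite.unop_smul, MulOpposite.unop_mul, unop_homActOp,
    LinearMap.sub_apply, LinearMap.smul_apply, Module.End.mul_apply]
  rw [homAct_apply hy hey, homAct_apply hx hex, homAct_apply hx hex, homAct_apply hx hex,
    homAct_apply hy hey, homAct_apply hy hey,
    homAct_apply (hx.bracket hy) (mul_bracket a b hex hey), superAd_bracket a b hx hy,
    ← ofP_rel a b hx hy hex hey, h1, twist_superAd b a hy, twist_twist, twist_twist,
    add_comm b a, mul_comm b a]
  simp only [add_mul, mul_sub, map_sub, map_smul, smul_add, smul_mul_assoc, mul_smul_comm,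
    mul_assoc]
  abel

theorem homActOp_kill {e : q L} (x : q L) (hex : e * x = 0) : homActOp e x = 0 :=
  MulOpposite.unop_injective (by rw [unop_homActOp, homAct_kill hex, MulOpposite.unop_zero])

/-- The action of the enveloping algebra of `e 𝔮_L` extending `homAct`. -/
noncomputable def homActP (e : q L) : UP e →ₐ[ℂ] (Module.End ℂ (q L →ₗ[ℂ] UP e))ᵐᵒᵖ :=
  liftP (e := e) (B := (Module.End ℂ (q L →ₗ[ℂ] UP e))ᵐᵒᵖ) (homActOp e)
    (fun a b x y hx hy hex hey => homActOp_rel a b x y hx hy hex hey)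
    (fun x hex => homActOp_kill x hex)

/-- The right action of `𝔮_L` on the enveloping algebra of `e 𝔮_L`, for which `(1 - e) 𝔮_L` annihilates
the unit: the map `u ↦ u x`. -/
noncomputable def rho (e x : q L) : UP e →ₗ[ℂ] UP e where
  toFun u := (homActP e u).unop (ofP e) x
  map_add' u v := by simp
  map_smul' c u := by simp

theorem rho_one (e x : q L) : rho e x 1 = ofP e x := by
  simp [rho]

/-- This is (u z) x = ± (u x) z + u [z, x], forced in any right action. With the value at 1 it
determines `rho`, and all later facts about `rho` are proved by induction along it. -/
theorem rho_mul {e : q L} {a : ZMod 2} {z : q L} (hz : IsHomog a (z : Mat L)) (hez : e * z = z)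
    (x : q L) (u : UP e) :
    rho e x (u * ofP e z) = rho e (twist a x) u * ofP e z + rho e (superAd a z x) u := by
  change (homActP e (u * ofP e z)).unop (ofP e) x = _
  rw [map_mul, MulOpposite.unop_mul, Module.End.mul_apply]
  have h : (homActP e (ofP e z)).unop = homAct e z := by
    rw [homActP, liftP_ofP]; rfl
  rw [h, homAct_apply hz hez]
  rfl

theorem rho_add (e x y : q L) (u : UP e) : rho e (x + y) u = rho e x u + rho e y u := by
  change (homActP e u).unop (ofP e) (x + y) = _
  rw [map_add]; rfl

theorem rho_smul (e : q L) (c : ℂ) (x : q L) (u : UP e) : rho e (c • x) u = c • rho e x u := by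
  change (homActP e u).unop (ofP e) (c • x) = _
  rw [map_smul]; rfl

/-- `rho` as a linear map. -/
noncomputable def rhoLin (e : q L) : q L →ₗ[ℂ] Module.End ℂ (UP e) where
  toFun := rho e
  map_add' x y := by ext u; exact rho_add e x y u
  map_smul' c x := by ext u; exact rho_smul e c x u

theorem mul_part {e : q L} (h0 : IsHomog 0 (e : Mat L)) (b : ZMod 2) (x : q L) :
    e * part b x = part b (e * x) := by
  simp only [part, LinearMap.smul_apply, LinearMap.add_apply, LinearMap.id_apply, parityQ_mul,
    parityQ_of_isHomog h0, sgn_zero, one_smul, mul_smul_comm, mul_add]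

theorem ofP_superAd {e : q L} (h0 : IsHomog 0 (e : Mat L)) {a : ZMod 2} {z x : q L}
    (hz : IsHomog a (z : Mat L)) (hez : e * z = z) (hex : e * x = x) :
    ofP e (superAd a z x) = ofP e z * ofP e x - ofP e (twist a x) * ofP e z := by
  have key : ∀ b, ofP e (superAd a z (part b x))
      = ofP e z * ofP e (part b x) - ofP e (twist a (part b x)) * ofP e z := fun b => by
    have hb := isHomog_part b x
    rw [superAd_of_isHomog a z hb, ← ofP_rel a b hz hb hez (by rw [mul_part h0, hex]),
      twist_of_isHomog a hb, map_smul, smul_mul_assoc]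
  rw [← part_add_part x]
  simp only [map_add, key, mul_add, add_mul]
  abel

/-- Right multiplication satisfies the recursion `rho_mul` because of the relations of `UP e`, and
agrees with `rho` at 1. -/
theorem rho_of_mem {e : q L} (he : e * e = e) (h0 : IsHomog 0 (e : Mat L)) {x : q L}
    (hex : e * x = x) (u : UP e) : rho e x u = u * ofP e x := by
  let S : Submodule ℂ (UP e) :=
    { carrier := {u | ∀ x, e * x = x → rho e x u = u * ofP e x}
      add_mem' := fun {u v} hu hv x hex => by rw [map_add, hu x hex, hv x hex, add_mul]
      zero_mem' := fun x _ => by rw [map_zero, zero_mul]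
      smul_mem' := fun c u hu x hex => by rw [map_smul, hu x hex, smul_mul_assoc] }
  refine UP_submodule_eq_top he h0 S (fun x _ => by rw [rho_one, one_mul]) ?_ u x hex
  intro u hu a z hz hez x hex
  have het : e * twist a x = twist a x := by
    have h := twist_mul a e x
    rw [twist_of_isHomog a h0, mul_zero, sgn_zero, one_smul, hex] at h
    exact h.symm
  have hes : e * superAd a z x = superAd a z x := by
    rw [superAd_apply, mul_sub, ← mul_assoc, ← mul_assoc, hez, het]
  rw [rho_mul hz hez, hu _ het, hu _ hes, ofP_superAd h0 hz hez hex]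
  simp only [mul_sub, mul_assoc]
  abel

/-- The maps `rho e x` form a right representation of the Lie superalgebra `𝔮_L`. -/
theorem rho_bracket {e : q L} (he : e * e = e) (h0 : IsHomog 0 (e : Mat L)) (u : UP e) :
    ∀ (a b : ZMod 2) (x y : q L), IsHomog a (x : Mat L) → IsHomog b (y : Mat L) →
      rho e y (rho e x u) - sgn (a * b) • rho e x (rho e y u) = rho e (bracket a b x y) u := by
  let S : Submodule ℂ (UP e) :=
    { carrier := {u | ∀ (a b : ZMod 2) (x y : q L), IsHomog a (x : Mat L) → IsHomog b (y : Mat L) →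
        rho e y (rho e x u) - sgn (a * b) • rho e x (rho e y u) = rho e (bracket a b x y) u}
      add_mem' := fun {u v} hu hv a b x y hx hy => by
        simp only [map_add, ← hu a b x y hx hy, ← hv a b x y hx hy, smul_add]
        abel
      zero_mem' := fun a b x y hx hy => by simp
      smul_mem' := fun c u hu a b x y hx hy => by
        simp only [map_smul, ← hu a b x y hx hy, smul_sub, smul_comm c] }
  refine UP_submodule_eq_top he h0 S ?_ ?_ u
  -- At u = 1 the first operator gives the image of e x; one use of the recursion for each order
  -- reduces the claim to the relation between e x and e y in `UP e`.
  · intro a b x y hx hy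
    have hex : e * (e * x) = e * x := by rw [← mul_assoc, he]
    have hey : e * (e * y) = e * y := by rw [← mul_assoc, he]
    have hx' : IsHomog a ((e * x : q L) : Mat L) := by simpa using h0.mul hx
    have hy' : IsHomog b ((e * y : q L) : Mat L) := by simpa using h0.mul hy
    have hr := ofP_rel a b hx' hy' hex hey
    have h1 : ∀ x y : q L, IsHomog a (x : Mat L) → IsHomog b (y : Mat L) →
      ofP e (bracket a b x y) = ofP e (e * x * y) - sgn (a * b) • ofP e (e * y * x) := by
      intro x y _ _
      rw [← ofP_proj he, bracket, mul_sub, mul_smul_comm, map_sub, map_smul, mul_assoc, mul_assoc]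
    rw [rho_one, rho_one, rho_one, ← ofP_proj he x, ← ofP_proj he y]
    have e1 := rho_mul hx' hex y 1
    have e2 := rho_mul hy' hey x 1
    rw [one_mul, rho_one, rho_one] at e1 e2
    rw [e1, e2, h1 x y hx hy]
    rw [twist_of_isHomog a hy, twist_of_isHomog b hx]
    simp only [superAd_apply, twist_of_isHomog a hy, twist_of_isHomog b hx, map_smul, map_sub,
      smul_mul_assoc]
    rw [h1 _ _ hx' hy', hex, hey] at hr
    rw [← ofP_proj he x, ← ofP_proj he y, ← ofP_proj he (x * (e * y)),
      ← ofP_proj he (y * (e * x)), ← mul_assoc e x, ← mul_assoc e y, mul_comm b a]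
    rw [sub_eq_iff_eq_add] at hr
    simp only [hr, smul_sub, smul_add, smul_smul, sgn_mul_self, one_smul]
    abel
  -- For u z, apply the hypothesis on u to the pairs (x, [z, y]), ([z, x], y) and (x, y); the Jacobi
  -- identity matches the terms.
  · intro u hu c z hz hez a b x y hx hy
    have g1 := hu a (c + b) x (bracket c b z y) hx (hz.bracket hy)
    have g2 := hu (c + a) b (bracket c a z x) y (hz.bracket hx) hy
    have g3 := hu a b x y hx hy
    have r : ∀ {d : ZMod 2} {w : q L}, IsHomog d (w : Mat L) → ∀ v : UP e,
        rho e w (v * ofP e z) = sgn (c * d) • (rho e w v * ofP e z) + rho e (bracket c d z w) v := by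
      intro d w hw v
      rw [rho_mul hz hez, twist_of_isHomog c hw, rho_smul, smul_mul_assoc, superAd_of_isHomog c z hw]
    rw [r hx, r hy, r (hx.bracket hy), ← g3, jacobi, rho_add, rho_smul, ← g1, ← g2]
    simp only [map_add, map_smul, r hx, r hy, sub_mul, mul_add, add_mul, sgn_add, mul_comm a c,
      smul_mul_assoc]
    rcases sgn_eq_or (a * b) with h1 | h1 <;> rcases sgn_eq_or (c * a) with h2 | h2 <;>
      rcases sgn_eq_or (c * b) with h3 | h3 <;>
      simp only [h1, h2, h3] <;> module

/-- The linear map `rhoLin` with values in the opposite algebra. -/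
noncomputable def rhoOp (e : q L) : q L →ₗ[ℂ] (Module.End ℂ (UP e))ᵐᵒᵖ := opLin (rhoLin e)

theorem rhoOp_rel {e : q L} (he : e * e = e) (h0 : IsHomog 0 (e : Mat L)) (a b : ZMod 2)
    (x y : q L) (hx : IsHomog a (x : Mat L)) (hy : IsHomog b (y : Mat L)) :
    rhoOp e x * rhoOp e y - sgn (a * b) • (rhoOp e y * rhoOp e x) = rhoOp e (bracket a b x y) :=
  MulOpposite.unop_injective (LinearMap.ext fun u => rho_bracket he h0 u a b x y hx hy)

/-- The right action of `U(𝔮_L)` on the enveloping algebra of `e 𝔮_L`. -/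
noncomputable def parabolicAct {e : q L} (he : e * e = e) (h0 : IsHomog 0 (e : Mat L)) :
    U L →ₐ[ℂ] (Module.End ℂ (UP e))ᵐᵒᵖ :=
  liftU (rhoOp e) (rhoOp_rel he h0)

theorem parabolicAct_ofQ {e : q L} (he : e * e = e) (h0 : IsHomog 0 (e : Mat L)) (x : q L) :
    (parabolicAct he h0 (ofQ L x)).unop = rho e x := by
  rw [parabolicAct, liftU_ofQ]; rfl

end Parabolic

/-! ### The linear retraction of U(𝔮_L) onto U(𝔮_K) -/

section Retraction

variable {K L : ℕ}

/-- The upper left block of an element of `𝔮_L`. -/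
noncomputable def blockQ (h : K ≤ L) : q L →ₗ[ℂ] q K where
  toFun x := ⟨(inclMat h).transpose * (x : Mat L) * inclMat h, by
    have key : ∀ (x : Mat L) (i j : Idx K),
        ((inclMat h).transpose * x * inclMat h) i j = x (i.cast h) (j.cast h) := by
      intro x i j
      simp [Matrix.mul_apply, inclMat]
    rw [mem_q]
    intro i j
    rw [key, key]
    exact mem_q.1 x.2 (i.cast h) (j.cast h)⟩
  map_add' x y := by
    ext1
    simp [Matrix.mul_add, Matrix.add_mul]
  map_smul' c x := by
    ext1
    simp

/-- The idempotent of `𝔮_L` projecting onto the indices `i` with `|i| ≤ K`. -/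
noncomputable def cut (h : K ≤ L) : q L := inclQ h 1

theorem cut_mul_self (h : K ≤ L) : cut h * cut h = cut h := by
  rw [cut, ← inclQ_mul, mul_one]

theorem isHomog_cut (h : K ≤ L) : IsHomog 0 (cut h : Mat L) := by
  apply IsHomog.inclQ
  exact isHomog_one

theorem coe_cut (h : K ≤ L) : (cut h : Mat L) = inclMat h * (inclMat h).transpose := by
  change inclMat h * (1 : Mat K) * (inclMat h).transpose = _
  rw [Matrix.mul_one]

theorem cut_mul_inclQ (h : K ≤ L) (x : q K) : cut h * inclQ h x = inclQ h x := by
  rw [cut, ← inclQ_mul, one_mul]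

theorem blockQ_inclQ (h : K ≤ L) (x : q K) : blockQ h (inclQ h x) = x := by
  ext1
  change (inclMat h).transpose * (inclMat h * (x : Mat K) * (inclMat h).transpose) * inclMat h = _
  calc _ = ((inclMat h).transpose * inclMat h) * (x : Mat K)
        * ((inclMat h).transpose * inclMat h) := by simp only [Matrix.mul_assoc]
    _ = _ := by rw [inclMat_transpose_mul, Matrix.one_mul, Matrix.mul_one]

theorem blockQ_cut_mul (h : K ≤ L) (x : q L) : blockQ h (cut h * x) = blockQ h x := by
  ext1
  change (inclMat h).transpose * ((cut h : Mat L) * (x : Mat L)) * inclMat h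
    = (inclMat h).transpose * (x : Mat L) * inclMat h
  calc _ = ((inclMat h).transpose * inclMat h) * (inclMat h).transpose * (x : Mat L)
        * inclMat h := by rw [coe_cut]; simp only [Matrix.mul_assoc]
    _ = _ := by rw [inclMat_transpose_mul, Matrix.one_mul]

/-- Rows of y beyond K vanish, so the middle summation index of the product stays within the block.
Taking blocks is thus multiplicative on e𝔮_L, though not on 𝔮_L. -/
theorem blockQ_mul (h : K ≤ L) (x : q L) {y : q L} (hy : cut h * y = y) :
    blockQ h (x * y) = blockQ h x * blockQ h y := by
  have e : (y : Mat L) = inclMat h * ((inclMat h).transpose * (y : Mat L)) := by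
    have h1 : (cut h : Mat L) * (y : Mat L) = (y : Mat L) :=
      congrArg (fun z : q L => (z : Mat L)) hy
    rw [← Matrix.mul_assoc, ← coe_cut, h1]
  ext1
  change (inclMat h).transpose * ((x : Mat L) * (y : Mat L)) * inclMat h
    = ((inclMat h).transpose * (x : Mat L) * inclMat h)
      * ((inclMat h).transpose * (y : Mat L) * inclMat h)
  conv_lhs => rw [e]
  simp only [Matrix.mul_assoc]

theorem isHomog_blockQ (h : K ≤ L) {d : ZMod 2} {x : q L} (hx : IsHomog d (x : Mat L)) :
    IsHomog d (blockQ h x : Mat K) := by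
  intro i j hij
  have key : (blockQ h x : Mat K) i j = (x : Mat L) (i.cast h) (j.cast h) := by
    change ((inclMat h).transpose * (x : Mat L) * inclMat h) i j = _
    simp [Matrix.mul_apply, inclMat]
  exact hx (i.cast h) (j.cast h) (by rwa [← key])

/-- The homomorphism from the enveloping algebra of the subalgebra of matrices with vanishing rows
`i`, `|i| > K`, to `U(𝔮_K)`. -/
noncomputable def blockP (h : K ≤ L) : UP (cut h) →ₐ[ℂ] U K :=
  liftP (ofQ K ∘ₗ blockQ h)
    (by
      intro a b x y hx hy hex hey
      have e : blockQ h (bracket a b x y) = bracket a b (blockQ h x) (blockQ h y) := by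
        simp only [bracket, map_sub, map_smul, blockQ_mul h x hey, blockQ_mul h y hex]
      simp only [LinearMap.comp_apply, e]
      exact ofQ_rel a b _ _ (isHomog_blockQ h hx) (isHomog_blockQ h hy))
    (by
      intro x hex
      rw [LinearMap.comp_apply, ← blockQ_cut_mul, hex, map_zero, map_zero])

/-- A linear retraction of `U(𝔮_L)` onto `U(𝔮_K)`. -/
noncomputable def retract (h : K ≤ L) (X : U L) : U K :=
  blockP h ((parabolicAct (cut_mul_self h) (isHomog_cut h) X).unop 1)

theorem retract_inclU (h : K ≤ L) (Z : U K) : retract h (inclU h Z) = Z := by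
  -- The claim for the vector 1 alone is not stable under products; for all u it says that `blockP`
  -- intertwines the action of `inclU h Z` with right multiplication by Z.
  let S : Subalgebra ℂ (U K) :=
    { carrier := {Z | ∀ u, blockP h ((parabolicAct (cut_mul_self h) (isHomog_cut h)
        (inclU h Z)).unop u) = blockP h u * Z}
      mul_mem' := fun {Y Z} hY hZ u => by
        rw [map_mul, map_mul, MulOpposite.unop_mul, Module.End.mul_apply, hZ, hY, mul_assoc]
      add_mem' := fun {Y Z} hY hZ u => by
        rw [map_add, map_add, MulOpposite.unop_add, LinearMap.add_apply, map_add, hY, hZ, mul_add]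
      algebraMap_mem' := fun c u => by
        rw [AlgHom.commutes, AlgHom.commutes, MulOpposite.algebraMap_apply, MulOpposite.unop_op,
          Module.algebraMap_end_apply, map_smul, Algebra.smul_def, Algebra.commutes] }
  have key := ringQuot_subalgebra_eq_top S (fun x u => by
    change blockP h ((parabolicAct (cut_mul_self h) (isHomog_cut h)
      (inclU h (ofQ K x))).unop u) = blockP h u * ofQ K x
    rw [inclU, liftU_ofQ, LinearMap.comp_apply, parabolicAct_ofQ,
      rho_of_mem (cut_mul_self h) (isHomog_cut h) (cut_mul_inclQ h x), map_mul, blockP, liftP_ofP,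
      LinearMap.comp_apply, blockQ_inclQ]) Z 1
  rw [retract, key, map_one, one_mul]

theorem parabolicAct_ofQ_one (h : K ≤ L) {x : q L} (hx : cut h * x = 0) :
    (parabolicAct (cut_mul_self h) (isHomog_cut h) (ofQ L x)).unop 1 = 0 := by
  rw [parabolicAct_ofQ, rho_one, ofP_kill hx]

end Retraction
-- Commutation relations of the F_{ij}
section Relations

variable {K : ℕ}

theorem Fmat_opp (i j : Idx K) : Fmat i.opp j.opp = Fmat i j := by
  ext1
  change Matrix.single i.opp j.opp (1 : ℂ) + Matrix.single i.opp.opp j.opp.opp 1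
    = Matrix.single i j (1 : ℂ) + Matrix.single i.opp j.opp 1
  rw [opp_opp, opp_opp, add_comm]

theorem F_opp (i j : Idx K) : F i.opp j.opp = F i j := by
  rw [F, F, Fmat_opp]

theorem opp_eq_iff {i j : Idx K} : i.opp = j ↔ i = j.opp :=
  ⟨fun h => by rw [← h, opp_opp], fun h => by rw [h, opp_opp]⟩

theorem single_mul_single_ite (i j k l : Idx K) :
    Matrix.single i j (1 : ℂ) * Matrix.single k l 1 = if j = k then Matrix.single i l 1 else 0 := by
  split_ifs with h
  · rw [h, Matrix.single_mul_single_same, one_mul]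
  · rw [Matrix.single_mul_single_of_ne _ _ _ _ h]

theorem Fmat_mul (i j k l : Idx K) :
    Fmat i j * Fmat k l
      = (if j = k then Fmat i l else 0) + (if j.opp = k then Fmat i.opp l else 0) := by
  have h1 : j.opp = k.opp ↔ j = k := (oppEquiv K).injective.eq_iff
  ext1
  change (Matrix.single i j (1 : ℂ) + Matrix.single i.opp j.opp 1)
    * (Matrix.single k l (1 : ℂ) + Matrix.single k.opp l.opp 1) = _
  simp only [add_mul, mul_add, single_mul_single_ite, h1, opp_eq_iff.symm]
  split_ifs <;> (simp [Fmat, opp_opp]; try abel)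

theorem F_comm (i j k l : Idx K) :
    F i j * F k l = sgn ((i.2 + j.2) * (k.2 + l.2)) • (F k l * F i j)
      + ((if j = k then F i l else 0) + (if j.opp = k then F i.opp l else 0))
      - sgn ((i.2 + j.2) * (k.2 + l.2)) •
        ((if l = i then F k j else 0) + (if l.opp = i then F k j.opp else 0)) := by
  have h := ofQ_rel _ _ _ _ (isHomog_Fmat i j) (isHomog_Fmat k l)
  have e : Fmat k.opp j = Fmat k j.opp := by rw [← Fmat_opp k.opp j, opp_opp]
  rw [bracket, Fmat_mul, Fmat_mul, e, sub_eq_iff_eq_add] at h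
  simp only [map_add, map_sub, map_smul, apply_ite (ofQ K), map_zero] at h
  simp only [F]
  rw [h]
  abel

/-- The factor 1/2 is there because F_{ij} = F_{-i,-j}, so the sum over all index pairs meets each
element twice. -/
theorem Fmat_expand (x : q K) :
    x = ∑ i, ∑ j, ((1 / 2 : ℂ) * (x : Mat K) i j) • Fmat i j := by
  have h1 : (x : Mat K) = ∑ i, ∑ j, (x : Mat K) i j • Matrix.single i j (1 : ℂ) := by
    conv_lhs => rw [Matrix.matrix_eq_sum_single (x : Mat K)]
    simp
  have h2 : (x : Mat K) = ∑ i, ∑ j, (x : Mat K) i j • Matrix.single i.opp j.opp (1 : ℂ) := by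
    conv_lhs => rw [h1]
    rw [← (oppEquiv K).sum_comp]
    refine Finset.sum_congr rfl fun i _ => ?_
    rw [← (oppEquiv K).sum_comp]
    refine Finset.sum_congr rfl fun j _ => ?_
    change (x : Mat K) i.opp j.opp • _ = _
    rw [mem_q.1 x.2]
    rfl
  ext1
  have h3 : (x : Mat K) = (1 / 2 : ℂ) • ((x : Mat K) + (x : Mat K)) := by module
  refine h3.trans ((congrArg₂ (fun a b => (1 / 2 : ℂ) • (a + b)) h1 h2).trans ?_)
  simp only [← Finset.sum_add_distrib, ← smul_add, Finset.smul_sum]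
  simp only [AddSubmonoidClass.coe_finsetSum, SetLike.val_smul]
  refine Finset.sum_congr rfl fun i _ => Finset.sum_congr rfl fun j _ => ?_
  rw [smul_smul]
  rfl

theorem U_subalgebra_eq_top (S : Subalgebra ℂ (U K)) (h : ∀ i j, F i j ∈ S) : ∀ u, u ∈ S := by
  refine ringQuot_subalgebra_eq_top S fun x => ?_
  change ofQ K x ∈ S
  rw [Fmat_expand x]
  simp only [map_sum, map_smul]
  exact S.sum_mem fun i _ => S.sum_mem fun j _ => S.smul_mem (h i j) _

theorem U_submodule_eq_top (S : Submodule ℂ (U K)) (h1 : 1 ∈ S)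
    (h : ∀ u ∈ S, ∀ i j, u * F i j ∈ S) : ∀ u, u ∈ S := by
  refine ringQuot_submodule_eq_top S h1 fun u hu x => ?_
  change u * ofQ K x ∈ S
  rw [Fmat_expand x]
  simp only [map_sum, map_smul, Finset.mul_sum, mul_smul_comm]
  exact S.sum_mem fun i _ => S.sum_mem fun j _ => S.smul_mem _ (h u hu i j)

end Relations

/-! ### Commutation relations of F^{(n)} and C^{(n)} -/

section Central

variable {K : ℕ}

theorem Fn_one (i j : Idx K) : Fn K 1 i j = F i j := by
  simp [Fn, sgn_zero, Fin.snoc]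

theorem Fn_succ (m : ℕ) (i j : Idx K) :
    Fn K (m + 2) i j = ∑ x : Idx K, sgn x.2 • (F i x * Fn K (m + 1) x j) := by
  simp only [Fn, Finset.mul_sum, Finset.smul_sum]
  rw [← (Fin.consEquiv (fun _ : Fin (m + 1) => Idx K)).sum_comp, Fintype.sum_prod_type]
  refine Finset.sum_congr rfl fun x _ => Finset.sum_congr rfl fun k _ => ?_
  have e : (Fin.snoc (Fin.cons x k : Fin (m + 1) → Idx K) j : Fin (m + 2) → Idx K)
      = Fin.cons x (Fin.snoc k j : Fin (m + 1) → Idx K) :=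
    (Fin.cons_snoc_eq_snoc_cons x k j).symm
  change sgn (∑ t, ((Fin.cons x k : Fin (m + 1) → Idx K) t).2) • (List.ofFn fun t : Fin (m + 2) =>
    F ((Fin.cons i (Fin.cons x k : Fin (m + 1) → Idx K) : Fin (m + 2) → Idx K) t)
      ((Fin.snoc (Fin.cons x k : Fin (m + 1) → Idx K) j : Fin (m + 2) → Idx K) t)).prod = _
  rw [e, List.ofFn_succ, List.prod_cons, Fin.sum_univ_succ]
  simp only [Fin.cons_zero, Fin.cons_succ]
  rw [sgn_add, mul_smul, mul_smul_comm]

/-- Splitting off the last factor suits a right ideal: a congruence for the remaining product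
survives multiplication by that factor on the right. -/
theorem Fn_succ' (m : ℕ) (i j : Idx K) :
    Fn K (m + 2) i j = ∑ x : Idx K, sgn x.2 • (Fn K (m + 1) i x * F x j) := by
  induction m generalizing i j with
  | zero => simp only [Fn_succ, zero_add, Fn_one]
  | succ m ih =>
    rw [Fn_succ]
    conv_lhs => simp only [ih]
    conv_rhs => simp only [Fn_succ m]
    simp only [Finset.mul_sum, Finset.sum_mul, Finset.smul_sum, mul_smul_comm,
      smul_mul_assoc, mul_assoc]
    rw [Finset.sum_comm]
    exact Finset.sum_congr rfl fun x _ => Finset.sum_congr rfl fun y _ => smul_comm _ _ _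

theorem parityU_Fn (m : ℕ) (i j : Idx K) :
    parityU K (Fn K (m + 1) i j) = sgn (i.2 + j.2) • Fn K (m + 1) i j := by
  induction m generalizing i j with
  | zero => rw [zero_add, Fn_one, parityU_F]
  | succ m ih =>
    rw [Fn_succ, map_sum, Finset.smul_sum]
    refine Finset.sum_congr rfl fun x _ => ?_
    have h2 : ∀ u v w : ZMod 2, u + w = u + v + (v + w) := by decide
    rw [map_smul, map_mul, ih, parityU_F, smul_mul_smul_comm, ← sgn_add, ← h2, smul_comm]

/-- The rule of `F_comm` with F_{kl} replaced by F^{(n)}_{kl}. By induction, commuting past F_{kx}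
and then past the shorter element gives the end terms and extra terms at the summation index x; the
latter cancel in the sum. -/
theorem F_mul_Fn (m : ℕ) (i j k l : Idx K) :
    F i j * Fn K (m + 1) k l = sgn ((i.2 + j.2) * (k.2 + l.2)) • (Fn K (m + 1) k l * F i j)
      + ((if j = k then Fn K (m + 1) i l else 0) + (if j.opp = k then Fn K (m + 1) i.opp l else 0))
      - sgn ((i.2 + j.2) * (k.2 + l.2)) •
        ((if l = i then Fn K (m + 1) k j else 0)
          + (if l.opp = i then Fn K (m + 1) k j.opp else 0)) := by
  induction m generalizing k l with
  | zero => simp only [zero_add, Fn_one, F_comm i j k l]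
  | succ m ih =>
    set s : Idx K → ℂ := fun x => sgn ((i.2 + j.2) * (k.2 + x.2)) with hs
    have hst : ∀ x, s l = s x * sgn ((i.2 + j.2) * (x.2 + l.2)) := by
      intro x
      have h2 : ∀ u v w : ZMod 2, u + w = u + v + (v + w) := by decide
      rw [hs, ← sgn_add, ← mul_add, ← h2]
    have term : ∀ x, F i j * (sgn x.2 • (F k x * Fn K (m + 1) x l))
        = s l • (sgn x.2 • (F k x * Fn K (m + 1) x l) * F i j)
          + ((if j = k then sgn x.2 • (F i x * Fn K (m + 1) x l) else 0)
            + (if j.opp = k then sgn x.2 • (F i.opp x * Fn K (m + 1) x l) else 0))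
          - s l • ((if l = i then sgn x.2 • (F k x * Fn K (m + 1) x j) else 0)
            + (if l.opp = i then sgn x.2 • (F k x * Fn K (m + 1) x j.opp) else 0))
          + (((if j = x then (sgn x.2 * s x) • (F k x * Fn K (m + 1) i l) else 0)
              + (if j.opp = x then (sgn x.2 * s x) • (F k x * Fn K (m + 1) i.opp l) else 0))
            - ((if i = x then (sgn x.2 * s x) • (F k j * Fn K (m + 1) x l) else 0)
              + (if i.opp = x then (sgn x.2 * s x) • (F k j.opp * Fn K (m + 1) x l) else 0))) := by
      intro x
      have c1 : x = i ↔ i = x := eq_comm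
      have c2 : x.opp = i ↔ i.opp = x := by rw [opp_eq_iff, eq_comm]
      rw [mul_smul_comm, ← mul_assoc, F_comm i j k x]
      change sgn x.2 • ((s x • _ + _ - s x • _) * _) = _
      rw [sub_mul, add_mul, smul_mul_assoc, mul_assoc (F k x), ih x l, hst x]
      simp only [c1, c2]
      generalize sgn ((i.2 + j.2) * (x.2 + l.2)) = t
      simp only [mul_add, mul_sub, add_mul, mul_ite, ite_mul, mul_zero, zero_mul, mul_smul_comm,
        smul_mul_assoc, mul_assoc, smul_add, smul_sub]
      simp only [← smul_ite_zero, smul_smul]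
      module
    have cancel : ∑ x, (((if j = x then (sgn x.2 * s x) • (F k x * Fn K (m + 1) i l) else 0)
              + (if j.opp = x then (sgn x.2 * s x) • (F k x * Fn K (m + 1) i.opp l) else 0))
            - ((if i = x then (sgn x.2 * s x) • (F k j * Fn K (m + 1) x l) else 0)
              + (if i.opp = x then (sgn x.2 * s x) • (F k j.opp * Fn K (m + 1) x l) else 0))) = 0 := by
      -- The terms x = j and x = i, and likewise x = -j and x = -i, carry the same product; the
      -- signs (-1)^{k̄} in the definition of F^{(n)} are exactly what makes their coefficients
      -- agree.
      have hz : ∀ u v w : ZMod 2, v + (u + v) * (w + v) = u + (u + v) * (w + u) := by decide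
      have hz' : ∀ u v w : ZMod 2,
        v + 1 + (u + v) * (w + (v + 1)) = u + 1 + (u + v) * (w + (u + 1)) := by decide
      simp only [Finset.sum_sub_distrib, Finset.sum_add_distrib, Finset.sum_ite_eq,
        Finset.mem_univ, if_true, hs, ← sgn_add]
      simp only [Idx.opp, hz i.2 j.2 k.2, hz' i.2 j.2 k.2, sub_self]
    simp only [Fn_succ m, Finset.mul_sum, term]
    rw [Finset.sum_add_distrib, cancel, add_zero]
    simp only [Finset.sum_sub_distrib, Finset.sum_add_distrib, ← Finset.smul_sum, Finset.sum_mul]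
    congr 2
    · split_ifs <;> simp
    · split_ifs <;> simp

/-- Diagonal elements are even, so no sign appears, and summing over k makes the two pairs of delta
terms equal. -/
theorem F_mul_Cn (m : ℕ) (i j : Idx K) : F i j * Cn K (m + 1) = Cn K (m + 1) * F i j := by
  have h0 : ∀ u : ZMod 2, u + u = 0 := by decide
  have e : ∀ k : Idx K, F i j * Fn K (m + 1) k k = Fn K (m + 1) k k * F i j
      + (((if j = k then Fn K (m + 1) i k else 0) + (if j.opp = k then Fn K (m + 1) i.opp k else 0))
      - ((if i = k then Fn K (m + 1) k j else 0)
          + (if i.opp = k then Fn K (m + 1) k j.opp else 0))) := by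
    intro k
    have c1 : k = i ↔ i = k := eq_comm
    have c2 : k.opp = i ↔ i.opp = k := by rw [opp_eq_iff, eq_comm]
    rw [F_mul_Fn, h0, mul_zero, sgn_zero, one_smul, one_smul, add_sub_assoc]
    simp only [c1, c2]
  simp only [Cn, Finset.mul_sum, e, Finset.sum_mul, Finset.sum_add_distrib, Finset.sum_sub_distrib,
    Finset.sum_ite_eq, Finset.mem_univ, if_true, sub_self, add_zero]

theorem parityU_Cn (m : ℕ) : parityU K (Cn K (m + 1)) = Cn K (m + 1) := by
  have h0 : ∀ u : ZMod 2, u + u = 0 := by decide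
  simp only [Cn, map_sum, parityU_Fn, h0, sgn_zero, one_smul]

end Central

/-! ### Membership in A_N^M -/

section Centralizer

variable {N M : ℕ}

theorem mem_A_iff {X : U (N + M)} : X ∈ A N M ↔
    ∀ i j : Idx (N + M), N < i.abs → N < j.abs →
      X * F i j = F i j * (if i.2 + j.2 = 0 then X else parityU (N + M) X) :=
  superComm_qTail_iff X

/-- Every delta term of `F_mul_Fn` vanishes, since it would equate an index of absolute value > N
with one of absolute value ≤ N. -/
theorem Fn_mem_A (m : ℕ) (k l : Idx N) :
    Fn (N + M) (m + 1) (k.cast (Nat.le_add_right N M)) (l.cast (Nat.le_add_right N M)) ∈ A N M := by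
  rw [mem_A_iff]
  intro i j hi hj
  have hlt : ∀ (k : Idx N) (i : Idx (N + M)), N < i.abs →
      i ≠ k.cast (Nat.le_add_right N M) ∧ i.opp ≠ k.cast (Nat.le_add_right N M) := by
    intro k i hi
    have hk : (k.cast (Nat.le_add_right N M)).abs ≤ N := k.1.2
    have ho : i.opp.abs = i.abs := rfl
    constructor
    · rintro rfl; omega
    · intro h; rw [← h] at hk; omega
  have c2 : ∀ i k : Idx (N + M), k.opp = i ↔ i.opp = k := fun i k => by rw [opp_eq_iff, eq_comm]
  have h := F_mul_Fn m i j (k.cast (Nat.le_add_right N M)) (l.cast (Nat.le_add_right N M))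
  rw [if_neg (hlt k j hj).1, if_neg (hlt k j hj).2, if_neg (Ne.symm (hlt l i hi).1),
    if_neg fun h => (hlt l i hi).2 ((c2 _ _).1 h)] at h
  simp only [add_zero, smul_zero, sub_zero] at h
  have h' : ∀ d c : ZMod 2, (if d = 0 then Fn (N + M) (m + 1) (k.cast (Nat.le_add_right N M))
      (l.cast (Nat.le_add_right N M)) else sgn c • Fn (N + M) (m + 1)
        (k.cast (Nat.le_add_right N M)) (l.cast (Nat.le_add_right N M)))
      = sgn (d * c) • Fn (N + M) (m + 1) (k.cast (Nat.le_add_right N M))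
        (l.cast (Nat.le_add_right N M)) := by
    intro d c
    rcases zmod_two_cases d with rfl | rfl <;> simp [sgn_zero]
  rw [parityU_Fn, h', mul_smul_comm, h, smul_smul, sgn_mul_self, one_smul]

theorem Cn_mem_A (m : ℕ) : Cn (N + M) (m + 1) ∈ A N M := by
  rw [mem_A_iff]
  intro i j _ _
  rw [parityU_Cn, ite_self, F_mul_Cn]

end Centralizer

/-! ### Splitting the indices of 𝔮_L into those of 𝔮_K and ±L -/

section Index

variable {K L : ℕ}

/-- The indices `±L`, where `L = K + 1`. -/
def topIdx (hL : L = K + 1) (p : ZMod 2) : Idx L := (⟨K, by omega⟩, p)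

theorem topIdx_abs (hL : L = K + 1) (p : ZMod 2) : (topIdx hL p).abs = L := by
  simp [topIdx, Idx.abs, hL]

theorem topIdx_opp (hL : L = K + 1) (p : ZMod 2) : (topIdx hL p).opp = topIdx hL (p + 1) := rfl

theorem cast_opp (h : K ≤ L) (i : Idx K) : (i.cast h).opp = i.opp.cast h := rfl

theorem cast_abs_le (h : K ≤ L) (i : Idx K) : (i.cast h).abs ≤ K := i.1.2

theorem cast_ne (h : K ≤ L) (hL : L = K + 1) (i : Idx K) {j : Idx L} (hj : j.abs = L) :
    i.cast h ≠ j := by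
  rintro rfl
  have := cast_abs_le h i
  omega

theorem topIdx_opp_ne (hL : L = K + 1) (p : ZMod 2) : (topIdx hL p).opp ≠ topIdx hL p := by
  have key : ∀ p : ZMod 2, p + 1 ≠ p := by decide
  exact fun e => key p (congrArg Prod.snd e)

theorem eq_cast_or_eq_topIdx (h : K ≤ L) (hL : L = K + 1) (i : Idx L) :
    (∃ k : Idx K, i = k.cast h) ∨ ∃ p, i = topIdx hL p := by
  rcases Nat.lt_or_ge i.1.val K with hi | hi
  · exact Or.inl ⟨(⟨i.1.val, hi⟩, i.2), rfl⟩
  · refine Or.inr ⟨i.2, Prod.ext (Fin.ext ?_) rfl⟩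
    have := i.1.2
    change i.1.val = K
    omega

theorem sum_idx {V : Type} [AddCommMonoid V] (h : K ≤ L) (hL : L = K + 1) (f : Idx L → V) :
    ∑ i, f i = ∑ k : Idx K, f (k.cast h) + ∑ p, f (topIdx hL p) := by
  subst hL
  rw [Fintype.sum_prod_type, Fin.sum_univ_castSucc, Fintype.sum_prod_type]
  rfl

end Index

/-! ### The inclusion on generators and its compatibility with parity -/

section Inclusion

variable {K L : ℕ}

theorem inclU_ofQ (h : K ≤ L) (x : q K) : inclU h (ofQ K x) = ofQ L (inclQ h x) := by
  rw [inclU, liftU_ofQ]; rfl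

theorem inclMat_mul_single (h : K ≤ L) (i j : Idx K) :
    inclMat h * Matrix.single i j (1 : ℂ) * (inclMat h).transpose
      = Matrix.single (i.cast h) (j.cast h) 1 := by
  ext a b
  rw [Matrix.mul_apply, Finset.sum_eq_single j, Matrix.mul_apply, Finset.sum_eq_single i]
  · simp only [inclMat, Matrix.of_apply, Matrix.transpose_apply, Matrix.single_apply, and_self,
      if_true, mul_one, eq_comm (a := a), eq_comm (a := b), ite_and, ite_mul, one_mul, zero_mul]
  · intro c _ hc
    simp [Ne.symm hc]
  · simp
  · intro c _ hc
    rw [Matrix.mul_apply, Finset.sum_eq_zero, zero_mul]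
    intro d _
    simp [Ne.symm hc]
  · simp

theorem inclU_F (h : K ≤ L) (i j : Idx K) : inclU h (F i j) = F (i.cast h) (j.cast h) := by
  rw [F, inclU_ofQ, F]
  congr 1
  ext1
  change inclMat h * (Matrix.single i j (1 : ℂ) + Matrix.single i.opp j.opp 1)
    * (inclMat h).transpose = _
  rw [Matrix.mul_add, Matrix.add_mul, inclMat_mul_single, inclMat_mul_single]
  rfl

theorem parityU_inclU (h : K ≤ L) (Z : U K) :
    parityU L (inclU h Z) = inclU h (parityU K Z) := by
  let S : Subalgebra ℂ (U K) :=
    AlgHom.equalizer ((parityU L).comp (inclU h)) ((inclU h).comp (parityU K))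
  refine U_subalgebra_eq_top S (fun i j => ?_) Z
  change parityU L (inclU h (F i j)) = inclU h (parityU K (F i j))
  rw [inclU_F, parityU_F, parityU_F, map_smul, inclU_F]
  rfl

end Inclusion

/-! ### The right ideal I_L -/

section Ideal

variable {K L : ℕ}

theorem F_mem_I {i : Idx L} (hi : i.abs = L) (j : Idx L) : F i j ∈ I L := by
  rcases zmod_two_cases i.2 with h | h
  · exact Submodule.subset_span ⟨i, j, hi, h, rfl⟩
  · rw [← F_opp]
    refine Submodule.subset_span ⟨i.opp, j.opp, hi, ?_, rfl⟩
    change i.2 + 1 = 0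
    rw [h]; decide

theorem I_mul_mem {X : U L} (hX : X ∈ I L) (u : U L) : X * u ∈ I L :=
  (I L).smul_mem (MulOpposite.op u) hX

theorem I_smul_mem {X : U L} (c : ℂ) (hX : X ∈ I L) : c • X ∈ I L := by
  rw [Algebra.smul_def, Algebra.commutes]
  exact I_mul_mem hX _

/-- The right ideal `I_L` as a complex vector space. -/
noncomputable def idealSpace (L : ℕ) : Submodule ℂ (U L) where
  carrier := I L
  add_mem' := (I L).add_mem
  zero_mem' := (I L).zero_mem
  smul_mem' c _ hX := I_smul_mem c hX

theorem I_induction {S : AddSubmonoid (U L)} (hF : ∀ i j : Idx L, i.abs = L → F i j ∈ S)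
    (hm : ∀ X ∈ S, ∀ u, X * u ∈ S) {X : U L} (hX : X ∈ I L) : X ∈ S := by
  induction hX using Submodule.span_induction with
  | mem X h =>
    obtain ⟨i, j, hi, -, rfl⟩ := h
    exact hF i j hi
  | zero => exact S.zero_mem
  | add X Y _ _ hX hY => exact S.add_mem hX hY
  | smul u X _ hX => exact hm X hX u.unop

theorem parityU_mem_I {X : U L} (hX : X ∈ I L) : parityU L X ∈ I L := by
  let S : AddSubmonoid (U L) :=
    { carrier := {X | parityU L X ∈ I L}
      add_mem' := fun {X Y} hX hY => by
        change parityU L (X + Y) ∈ I L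
        rw [map_add]; exact (I L).add_mem hX hY
      zero_mem' := by
        change parityU L 0 ∈ I L
        rw [map_zero]; exact (I L).zero_mem }
  refine I_induction (S := S) (fun i j hi => ?_) (fun X hX u => ?_) hX
  · change parityU L (F i j) ∈ I L
    rw [parityU_F]
    exact I_smul_mem _ (F_mem_I hi j)
  · change parityU L (X * u) ∈ I L
    rw [map_mul]; exact I_mul_mem hX _

/-- The supercommutator of F_{ab}, |a|, |b| ≤ K, with a generator F_{±L,j} is again a combination of
elements with row index ±L, so left multiplication by F_{ab} preserves I_L. -/
theorem inclU_mul_mem_I (h : K ≤ L) (hL : L = K + 1) (Z : U K) {X : U L} (hX : X ∈ I L) :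
    inclU h Z * X ∈ I L := by
  let T : Subalgebra ℂ (U K) :=
    { carrier := {Z | ∀ X ∈ I L, inclU h Z * X ∈ I L}
      mul_mem' := fun {Y Z} hY hZ X hX => by
        rw [map_mul, mul_assoc]; exact hY _ (hZ _ hX)
      add_mem' := fun {Y Z} hY hZ X hX => by
        rw [map_add, add_mul]; exact (I L).add_mem (hY _ hX) (hZ _ hX)
      algebraMap_mem' := fun c X hX => by
        rw [AlgHom.commutes, ← Algebra.smul_def]; exact I_smul_mem c hX }
  refine U_subalgebra_eq_top T (fun a b X hX => ?_) Z X hX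
  rw [inclU_F]
  let S : AddSubmonoid (U L) :=
    { carrier := {X | F (a.cast h) (b.cast h) * X ∈ I L}
      add_mem' := fun {X Y} hX hY => by
        change F (a.cast h) (b.cast h) * (X + Y) ∈ I L
        rw [mul_add]; exact (I L).add_mem hX hY
      zero_mem' := by
        change F (a.cast h) (b.cast h) * 0 ∈ I L
        rw [mul_zero]; exact (I L).zero_mem }
  refine I_induction (S := S) (fun i j hi => ?_) (fun X hX u => ?_) hX
  · change F (a.cast h) (b.cast h) * F i j ∈ I L
    rw [F_comm, if_neg (cast_ne h hL b hi), cast_opp, if_neg (cast_ne h hL b.opp hi), add_zero,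
      add_zero]
    refine (I L).sub_mem (I_smul_mem _ (I_mul_mem (F_mem_I hi j) _)) (I_smul_mem _ ?_)
    refine (I L).add_mem ?_ ?_
    · split_ifs
      · exact F_mem_I hi _
      · exact (I L).zero_mem
    · split_ifs
      · exact F_mem_I hi _
      · exact (I L).zero_mem
  · change F (a.cast h) (b.cast h) * (X * u) ∈ I L
    rw [← mul_assoc]; exact I_mul_mem hX _

theorem inclMat_transpose_mul_single (h : K ≤ L) (hL : L = K + 1) {i : Idx L} (hi : i.abs = L)
    (j : Idx L) : (inclMat h).transpose * Matrix.single i j (1 : ℂ) = 0 := by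
  ext a b
  rw [Matrix.mul_apply]
  refine Finset.sum_eq_zero fun c _ => ?_
  by_cases hc : i = c
  · subst hc
    simp [inclMat, Ne.symm (cast_ne h hL a hi)]
  · simp [hc]

/-- The annihilator of the vector 1 in a right module is a right ideal, and it contains the
generators because their rows ±L are removed by `cut`. -/
theorem retract_of_mem_I (h : K ≤ L) (hL : L = K + 1) {X : U L} (hX : X ∈ I L) :
    retract h X = 0 := by
  let S : AddSubmonoid (U L) :=
    { carrier := {X | (parabolicAct (cut_mul_self h) (isHomog_cut h) X).unop 1 = 0}
      add_mem' := fun {X Y} hX hY => by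
        change (parabolicAct (cut_mul_self h) (isHomog_cut h) (X + Y)).unop 1 = 0
        rw [map_add, MulOpposite.unop_add, LinearMap.add_apply, hX, hY, add_zero]
      zero_mem' := by
        change (parabolicAct (cut_mul_self h) (isHomog_cut h) 0).unop 1 = 0
        rw [map_zero, MulOpposite.unop_zero, LinearMap.zero_apply] }
  have key : X ∈ S := by
    refine I_induction (S := S) (fun i j hi => ?_) (fun X hX u => ?_) hX
    · apply parabolicAct_ofQ_one
      ext1
      change (cut h : Mat L) * (Matrix.single i j (1 : ℂ) + Matrix.single i.opp j.opp 1) = 0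
      rw [coe_cut, Matrix.mul_assoc, Matrix.mul_add, inclMat_transpose_mul_single h hL hi,
        inclMat_transpose_mul_single h hL (i := i.opp) hi, add_zero, Matrix.mul_zero]
    · change (parabolicAct (cut_mul_self h) (isHomog_cut h) (X * u)).unop 1 = 0
      rw [map_mul, MulOpposite.unop_mul, Module.End.mul_apply, hX, map_zero]
  rw [retract, key, map_zero]

theorem eq_zero_of_inclU_mem_I (h : K ≤ L) (hL : L = K + 1) {Z : U K} (hZ : inclU h Z ∈ I L) :
    Z = 0 := by
  rw [← retract_inclU h Z, retract_of_mem_I h hL hZ]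

end Ideal

/-! ### Weights of right multiplication by F_{LL} modulo I_L -/

section Weight

variable {K L : ℕ}

/-- The subspaces of `U(𝔮_L)` spanned modulo `I_L` by the products of an element of `U(𝔮_K)` and of
`d` elements of the form `F_{iL}` with `|i| ≤ K`, where `L = K + 1`. -/
noncomputable def weightSpace (h : K ≤ L) (hL : L = K + 1) : ℕ → Submodule ℂ (U L)
  | 0 => (inclU h).range.toSubmodule ⊔ idealSpace L
  | d + 1 => idealSpace L ⊔ Submodule.span ℂ
      {Y | ∃ w ∈ weightSpace h hL d, ∃ i : Idx K, Y = w * F (i.cast h) (topIdx hL 0)}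

theorem idealSpace_le_weightSpace (h : K ≤ L) (hL : L = K + 1) (d : ℕ) :
    idealSpace L ≤ weightSpace h hL d := by
  cases d with
  | zero => exact le_sup_right
  | succ d => exact le_sup_left

theorem weightSpace_zero_induction (h : K ≤ L) (hL : L = K + 1) {S : Submodule ℂ (U L)}
    (hI : idealSpace L ≤ S) (hZ : ∀ Z, inclU h Z ∈ S) : weightSpace h hL 0 ≤ S := by
  refine sup_le ?_ hI
  rintro _ ⟨Z, rfl⟩
  exact hZ Z

theorem weightSpace_succ_induction (h : K ≤ L) (hL : L = K + 1) {d : ℕ} {S : Submodule ℂ (U L)}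
    (hI : idealSpace L ≤ S)
    (hF : ∀ w ∈ weightSpace h hL d, ∀ i : Idx K, w * F (i.cast h) (topIdx hL 0) ∈ S) :
    weightSpace h hL (d + 1) ≤ S := by
  refine sup_le hI (Submodule.span_le.2 ?_)
  rintro _ ⟨w, hw, i, rfl⟩
  exact hF w hw i

theorem mul_F_mem_weightSpace_succ (h : K ≤ L) (hL : L = K + 1) {d : ℕ} {w : U L}
    (hw : w ∈ weightSpace h hL d) (i : Idx K) (p : ZMod 2) :
    w * F (i.cast h) (topIdx hL p) ∈ weightSpace h hL (d + 1) := by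
  have key : ∀ i : Idx K, w * F (i.cast h) (topIdx hL 0) ∈ weightSpace h hL (d + 1) := fun i =>
    Submodule.mem_sup_right (Submodule.subset_span ⟨w, hw, i, rfl⟩)
  rcases zmod_two_cases p with rfl | rfl
  · exact key i
  · rw [← F_opp, cast_opp, topIdx_opp]
    exact key i.opp

theorem comap_mulRight_mem {S : Submodule ℂ (U L)} {u w : U L} :
    w ∈ S.comap (LinearMap.mulRight ℂ u) ↔ w * u ∈ S := Iff.rfl

/-- Shaped after the right side of `F_comm`: a product with two factors exchanged stays in S once
the exchanged product and those delta terms that actually occur do. -/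
theorem mul_relation_mem (S : Submodule ℂ (U L)) {P P' Q Q' : Prop} [Decidable P] [Decidable P']
    [Decidable Q] [Decidable Q'] {w a b x x' y y' : U L} (s : ℂ) (h : w * a * b ∈ S)
    (hx : P → w * x ∈ S) (hx' : P' → w * x' ∈ S) (hy : Q → w * y ∈ S) (hy' : Q' → w * y' ∈ S) :
    w * (s • (a * b) + ((if P then x else 0) + (if P' then x' else 0))
      - s • ((if Q then y else 0) + (if Q' then y' else 0))) ∈ S := by
  have key : ∀ (P : Prop) [Decidable P] (x : U L), (P → w * x ∈ S) →
      w * (if P then x else 0) ∈ S := by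
    intro P _ x hx
    split_ifs with hP
    · exact hx hP
    · rw [mul_zero]; exact S.zero_mem
  rw [mul_sub, mul_add, mul_smul_comm, mul_smul_comm, ← mul_assoc, mul_add, mul_add]
  exact sub_mem (add_mem (S.smul_mem _ h) (add_mem (key _ _ hx) (key _ _ hx')))
    (S.smul_mem _ (add_mem (key _ _ hy) (key _ _ hy')))

theorem idealSpace_le_comap {S : Submodule ℂ (U L)} (hS : idealSpace L ≤ S) (u : U L) :
    idealSpace L ≤ S.comap (LinearMap.mulRight ℂ u) :=
  fun _ hX => hS (I_mul_mem hX u)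

theorem mul_F_cast_mem_weightSpace (h : K ≤ L) (hL : L = K + 1) (d : ℕ) (a b : Idx K) :
    ∀ w ∈ weightSpace h hL d, w * F (a.cast h) (b.cast h) ∈ weightSpace h hL d := by
  have hle := fun d => idealSpace_le_comap (idealSpace_le_weightSpace h hL d)
    (F (a.cast h) (b.cast h))
  induction d with
  | zero =>
    refine weightSpace_zero_induction h hL (hle 0) fun Z => ?_
    rw [comap_mulRight_mem, ← inclU_F, ← map_mul]
    exact Submodule.mem_sup_left ⟨_, rfl⟩
  | succ d ih =>
    refine weightSpace_succ_induction h hL (hle (d + 1)) fun w hw i => ?_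
    rw [comap_mulRight_mem, mul_assoc, F_comm]
    exact mul_relation_mem _ _ (mul_F_mem_weightSpace_succ h hL (ih w hw) i 0)
      (fun e => absurd e.symm (cast_ne h hL a (topIdx_abs hL 0)))
      (fun e => absurd e.symm (cast_ne h hL a (topIdx_abs hL 1)))
      (fun _ => mul_F_mem_weightSpace_succ h hL hw a 0)
      (fun _ => mul_F_mem_weightSpace_succ h hL hw a 1)

theorem weightSpace_zero_mul_mem (h : K ≤ L) (hL : L = K + 1) (p : ZMod 2) (j : Idx L) :
    ∀ w ∈ weightSpace h hL 0, w * F (topIdx hL p) j ∈ I L := by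
  refine weightSpace_zero_induction h hL (idealSpace_le_comap le_rfl (F (topIdx hL p) j))
    fun Z => ?_
  rw [comap_mulRight_mem]
  exact inclU_mul_mem_I h hL Z (F_mem_I (topIdx_abs hL p) j)

theorem mul_F_top_mem_weightSpace (h : K ≤ L) (hL : L = K + 1) (d : ℕ) (p r : ZMod 2) :
    ∀ w ∈ weightSpace h hL d, w * F (topIdx hL p) (topIdx hL r) ∈ weightSpace h hL d := by
  induction d with
  | zero =>
    intro w hw
    exact idealSpace_le_weightSpace h hL 0 (weightSpace_zero_mul_mem h hL p _ w hw)
  | succ d ih =>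
    refine weightSpace_succ_induction h hL (idealSpace_le_comap
      (idealSpace_le_weightSpace h hL (d + 1)) _) fun w hw i => ?_
    rw [comap_mulRight_mem, mul_assoc, F_comm]
    exact mul_relation_mem _ _ (mul_F_mem_weightSpace_succ h hL (ih w hw) i 0)
      (fun _ => mul_F_mem_weightSpace_succ h hL hw i r)
      (fun _ => mul_F_mem_weightSpace_succ h hL hw i.opp r)
      (fun e => absurd e.symm (cast_ne h hL i (topIdx_abs hL r)))
      (fun e => absurd e.symm (cast_ne h hL i (topIdx_abs hL (r + 1))))

/-- The sum contains 1 and is stable under right multiplication by each type of generator. The type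
F_{±L,j} with |j| ≤ K comes last: exchanging it with F_{iL} produces the other types, and on weight
0 it lands in I_L. -/
theorem iSup_weightSpace (h : K ≤ L) (hL : L = K + 1) (X : U L) :
    X ∈ ⨆ d, weightSpace h hL d := by
  set T := ⨆ d, weightSpace h hL d with hT
  have hle : ∀ d, weightSpace h hL d ≤ T := le_iSup (weightSpace h hL)
  have hI : idealSpace L ≤ T := (idealSpace_le_weightSpace h hL 0).trans (hle 0)
  have extend : ∀ u : U L, (∀ d, ∀ w ∈ weightSpace h hL d, w * u ∈ T) → ∀ w ∈ T, w * u ∈ T :=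
    fun u hu => iSup_le (a := T.comap (LinearMap.mulRight ℂ u)) hu
  have h1 : ∀ (i : Idx K) (p : ZMod 2), ∀ w ∈ T, w * F (i.cast h) (topIdx hL p) ∈ T := fun i p =>
    extend _ fun d w hw => hle (d + 1) (mul_F_mem_weightSpace_succ h hL hw i p)
  have h2 : ∀ a b : Idx K, ∀ w ∈ T, w * F (a.cast h) (b.cast h) ∈ T := fun a b =>
    extend _ fun d w hw => hle d (mul_F_cast_mem_weightSpace h hL d a b w hw)
  have h3 : ∀ p r : ZMod 2, ∀ w ∈ T, w * F (topIdx hL p) (topIdx hL r) ∈ T := fun p r =>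
    extend _ fun d w hw => hle d (mul_F_top_mem_weightSpace h hL d p r w hw)
  have h4 : ∀ (p : ZMod 2) (j : Idx K), ∀ w ∈ T, w * F (topIdx hL p) (j.cast h) ∈ T := by
    intro p j
    refine extend _ fun d => ?_
    induction d with
    | zero => exact fun w hw => hI (weightSpace_zero_mul_mem h hL p _ w hw)
    | succ d ih =>
      refine weightSpace_succ_induction h hL (idealSpace_le_comap hI _) fun w hw i => ?_
      rw [comap_mulRight_mem, mul_assoc, F_comm]
      exact mul_relation_mem _ _ (h1 i 0 _ (ih w hw)) (fun _ => h2 i j w (hle d hw))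
        (fun _ => h2 i.opp j w (hle d hw)) (fun _ => h3 p 0 w (hle d hw))
        (fun _ => h3 p 1 w (hle d hw))
  refine U_submodule_eq_top T (hle 0 (Submodule.mem_sup_left ⟨1, map_one _⟩)) ?_ X
  intro w hw i j
  rcases eq_cast_or_eq_topIdx h hL i with ⟨i, rfl⟩ | ⟨p, rfl⟩ <;>
    rcases eq_cast_or_eq_topIdx h hL j with ⟨j, rfl⟩ | ⟨r, rfl⟩
  · exact h2 i j w hw
  · exact h1 i r w hw
  · exact h4 p j w hw
  · exact h3 p r w hw

/-- Each factor F_{iL} raises the eigenvalue by one, since [F_{iL}, F_{LL}] = F_{iL}; on weight 0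
the element F_{LL} moves to the left of U(𝔮_K) into I_L. -/
theorem weightSpace_weight (h : K ≤ L) (hL : L = K + 1) (d : ℕ) :
    ∀ w ∈ weightSpace h hL d,
      w * F (topIdx hL 0) (topIdx hL 0) - (d : ℂ) • w ∈ I L := by
  set t := topIdx hL 0 with ht
  let φ : ℕ → U L →ₗ[ℂ] U L := fun d => LinearMap.mulRight ℂ (F t t) - (d : ℂ) • LinearMap.id
  have hle : ∀ d, idealSpace L ≤ (idealSpace L).comap (φ d) := fun d X hX =>
    (idealSpace L).sub_mem (I_mul_mem hX _) (I_smul_mem _ hX)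
  change weightSpace h hL d ≤ (idealSpace L).comap (φ d)
  induction d with
  | zero =>
    refine weightSpace_zero_induction h hL (hle 0) fun Z => ?_
    change inclU h Z * F t t - ((0 : ℕ) : ℂ) • inclU h Z ∈ I L
    rw [Nat.cast_zero, zero_smul, sub_zero]
    exact inclU_mul_mem_I h hL Z (F_mem_I (topIdx_abs hL 0) _)
  | succ d ih =>
    refine weightSpace_succ_induction h hL (hle (d + 1)) fun w hw i => ?_
    have hw' : w * F t t - (d : ℂ) • w ∈ I L := ih hw
    have e : F (i.cast h) t * F t t = F t t * F (i.cast h) t + F (i.cast h) t := by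
      have h0 : ∀ u : ZMod 2, u + u = 0 := by decide
      rw [F_comm, if_pos rfl, if_neg (topIdx_opp_ne hL 0),
        if_neg (cast_ne h hL i (topIdx_abs hL _)).symm, ht, topIdx_opp,
        if_neg (cast_ne h hL i (topIdx_abs hL _)).symm, h0, mul_zero, sgn_zero, one_smul,
        add_zero, add_zero, smul_zero, sub_zero]
    change w * F (i.cast h) t * F t t - ((d + 1 : ℕ) : ℂ) • (w * F (i.cast h) t) ∈ I L
    have e2 : w * F (i.cast h) t * F t t - ((d + 1 : ℕ) : ℂ) • (w * F (i.cast h) t)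
        = (w * F t t - (d : ℂ) • w) * F (i.cast h) t := by
      rw [mul_assoc, e, mul_add, sub_mul, smul_mul_assoc, ← mul_assoc, Nat.cast_succ, add_smul,
        one_smul]
      abel
    rw [e2]
    exact I_mul_mem hw' _

theorem mul_aeval_sub_mem_I {X u : U L} {c : ℂ} (hX : X * u - c • X ∈ I L)
    (p : Polynomial ℂ) : X * Polynomial.aeval u p - p.eval c • X ∈ I L := by
  induction p using Polynomial.induction_on with
  | C a =>
    rw [Polynomial.aeval_C, Polynomial.eval_C, ← Algebra.commutes, ← Algebra.smul_def, sub_self]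
    exact (I L).zero_mem
  | add p r hp hr =>
    rw [map_add, Polynomial.eval_add, mul_add, add_smul, add_sub_add_comm]
    exact (I L).add_mem hp hr
  | monomial n a ih =>
    have e : X * Polynomial.aeval u (Polynomial.C a * Polynomial.X ^ (n + 1))
        - (Polynomial.C a * Polynomial.X ^ (n + 1)).eval c • X
        = (X * Polynomial.aeval u (Polynomial.C a * Polynomial.X ^ n)
          - (Polynomial.C a * Polynomial.X ^ n).eval c • X) * u
          + (Polynomial.C a * Polynomial.X ^ n).eval c • (X * u - c • X) := by
      rw [pow_succ, ← mul_assoc, map_mul, Polynomial.aeval_X, Polynomial.eval_mul,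
        Polynomial.eval_X, sub_mul, smul_sub, smul_smul, smul_mul_assoc, ← mul_assoc]
      abel
    rw [e]
    exact (I L).add_mem (I_mul_mem ih _) (I_smul_mem _ hX)

/-- An element commuting with `F_{LL}` belongs to `U(𝔮_K) + I_L`, where `L = K + 1`. -/
theorem exists_sub_inclU_mem_I (h : K ≤ L) (hL : L = K + 1) {X : U L}
    (hX : X * F (topIdx hL 0) (topIdx hL 0) = F (topIdx hL 0) (topIdx hL 0) * X) :
    ∃ Z : U K, X - inclU h Z ∈ I L := by
  set u := F (topIdx hL 0) (topIdx hL 0) with hu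
  obtain ⟨f, hf, hsum⟩ := (Submodule.mem_iSup_iff_exists_finsupp _ _).1 (iSup_weightSpace h hL X)
  have h0 : X * u - (0 : ℂ) • X ∈ I L := by
    rw [zero_smul, sub_zero, hX]
    exact I_mul_mem (F_mem_I (topIdx_abs hL 0) _) _
  -- This polynomial vanishes at the nonzero weights occurring in X but not at 0. Evaluating X
  -- p(F_{LL}) modulo I_L as p(0) X, and termwise as p(0) times the weight 0 part, identifies X with
  -- that part.
  let p : Polynomial ℂ :=
    ∏ d ∈ f.support.erase 0, (Polynomial.X - Polynomial.C (d : ℂ))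
  have hp0 : p.eval 0 ≠ 0 := by
    rw [Polynomial.eval_prod, Finset.prod_ne_zero_iff]
    intro d hd
    simpa using Finset.ne_of_mem_erase hd
  have hpd : ∀ d ∈ f.support, d ≠ 0 → p.eval (d : ℂ) = 0 := by
    intro d hd hd0
    rw [Polynomial.eval_prod]
    exact Finset.prod_eq_zero (Finset.mem_erase.2 ⟨hd0, hd⟩) (by simp)
  have e1 := mul_aeval_sub_mem_I h0 p
  have e2 : X * Polynomial.aeval u p - p.eval 0 • f 0 ∈ I L := by
    have e3 : X * Polynomial.aeval u p - p.eval 0 • f 0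
        = ∑ d ∈ insert 0 f.support, (f d * Polynomial.aeval u p - p.eval (d : ℂ) • f d) := by
      rw [Finset.sum_sub_distrib, ← Finset.sum_mul]
      congr 1
      · rw [← hsum, Finsupp.sum]
        congr 1
        refine Finset.sum_subset (Finset.subset_insert _ _) fun d _ hd => ?_
        simpa using hd
      · rw [Finset.sum_eq_single_of_mem 0 (Finset.mem_insert_self _ _), Nat.cast_zero]
        intro d hd hd0
        rw [hpd d (Finset.mem_of_mem_insert_of_ne hd hd0) hd0, zero_smul]
    rw [e3]
    exact (I L).sum_mem fun d _ => mul_aeval_sub_mem_I (weightSpace_weight h hL d _ (hf d)) p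
  have e4 : X - f 0 ∈ I L := by
    have e5 := I_smul_mem (p.eval 0)⁻¹ ((I L).sub_mem e2 e1)
    have e6 : (p.eval 0)⁻¹ • (X * Polynomial.aeval u p - p.eval 0 • f 0
        - (X * Polynomial.aeval u p - p.eval 0 • X)) = X - f 0 := by
      rw [sub_sub_sub_cancel_left, ← smul_sub (p.eval 0) X, smul_smul, inv_mul_cancel₀ hp0, one_smul]
    rwa [e6] at e5
  obtain ⟨_, ⟨Z, rfl⟩, Y, hY, hZY⟩ := Submodule.mem_sup.1 (hf 0)
  refine ⟨Z, ?_⟩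
  have e7 : X - inclU h Z = (X - f 0) + Y := by
    rw [← hZY]
    change X - inclU h Z = X - (inclU h Z + Y) + Y
    abel
  rw [e7]
  exact (I L).add_mem e4 hY

end Weight

/-! ### Images of F^{(n)} and C^{(n)} modulo I_L -/

section Projection

variable {K L : ℕ}

theorem Fn_mem_I (m : ℕ) {i : Idx L} (hi : i.abs = L) (j : Idx L) : Fn L (m + 1) i j ∈ I L := by
  cases m with
  | zero => rw [zero_add, Fn_one]; exact F_mem_I hi j
  | succ m =>
    rw [Fn_succ]
    exact (I L).sum_mem fun x _ => I_smul_mem _ (I_mul_mem (F_mem_I hi x) _)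

/-- Move F_{±L,j} to the left, where it lies in I_L. Of the delta terms one is F^{(n)}_{ij}, and the
others have row index ±L. The residue does not depend on the sign of ±L. -/
theorem Fn_mul_F_sub_mem_I (h : K ≤ L) (hL : L = K + 1) (m : ℕ) (i j : Idx K) (p : ZMod 2) :
    Fn L (m + 1) (i.cast h) (topIdx hL p) * F (topIdx hL p) (j.cast h)
      - Fn L (m + 1) (i.cast h) (j.cast h) ∈ I L := by
  set G := Fn L (m + 1) (i.cast h) (topIdx hL p) with hG
  set s := sgn (((topIdx hL p).2 + (j.cast h).2) * ((i.cast h).2 + (topIdx hL p).2)) with hs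
  have e := F_mul_Fn m (topIdx hL p) (j.cast h) (i.cast h) (topIdx hL p)
  rw [if_pos rfl, if_neg (topIdx_opp_ne hL p), add_zero, ← hG, ← hs] at e
  set B := (if j.cast h = i.cast h then Fn L (m + 1) (topIdx hL p) (topIdx hL p) else 0)
    + (if (j.cast h).opp = i.cast h then Fn L (m + 1) (topIdx hL p).opp (topIdx hL p) else 0)
    with hB
  have hBI : B ∈ I L := by
    refine (I L).add_mem ?_ ?_
    · split_ifs
      · exact Fn_mem_I m (topIdx_abs hL p) _
      · exact (I L).zero_mem
    · split_ifs
      · exact Fn_mem_I m (topIdx_abs hL (p + 1)) _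
      · exact (I L).zero_mem
  have hss : s * s = 1 := sgn_mul_self _
  have e2 : G * F (topIdx hL p) (j.cast h) - Fn L (m + 1) (i.cast h) (j.cast h)
      = s • (F (topIdx hL p) (j.cast h) * G - B) := by
    rw [e]
    simp only [smul_add, smul_sub, smul_smul, hss, one_smul]
    abel
  rw [e2]
  exact I_smul_mem _ ((I L).sub_mem (I_mul_mem (F_mem_I (topIdx_abs hL p) _) _) hBI)

theorem Fn_sub_inclU_mem_I (h : K ≤ L) (hL : L = K + 1) (m : ℕ) (i j : Idx K) :
    Fn L (m + 1) (i.cast h) (j.cast h) - inclU h (Fn K (m + 1) i j) ∈ I L := by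
  induction m generalizing i j with
  | zero =>
    rw [zero_add, Fn_one, Fn_one, inclU_F, sub_self]
    exact (I L).zero_mem
  | succ m ih =>
    -- The residues at L and -L coincide and enter with signs 1 and -1, so they may be subtracted
    -- for free.
    have hz : ∑ p : ZMod 2, sgn (topIdx hL p).2 • Fn L (m + 1) (i.cast h) (j.cast h) = 0 := by
      have hu : (Finset.univ : Finset (ZMod 2)) = {0, 1} := by decide
      rw [hu, Finset.sum_pair (by decide)]
      change sgn 0 • _ + sgn 1 • _ = _
      rw [sgn_zero, sgn_one]
      module
    have e : Fn L (m + 2) (i.cast h) (j.cast h) - inclU h (Fn K (m + 2) i j)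
        = ∑ k : Idx K, sgn k.2 • ((Fn L (m + 1) (i.cast h) (k.cast h)
            - inclU h (Fn K (m + 1) i k)) * F (k.cast h) (j.cast h))
          + ∑ p : ZMod 2, sgn (topIdx hL p).2 • (Fn L (m + 1) (i.cast h) (topIdx hL p)
            * F (topIdx hL p) (j.cast h) - Fn L (m + 1) (i.cast h) (j.cast h)) := by
      rw [Fn_succ', Fn_succ', sum_idx h hL]
      simp only [smul_sub, Finset.sum_sub_distrib, hz, map_sum, map_smul, map_mul, inclU_F, sub_mul]
      simp only [sub_zero, sub_add_eq_add_sub]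
      rfl
    rw [e]
    exact (I L).add_mem
      ((I L).sum_mem fun k _ => I_smul_mem _ (I_mul_mem (ih i k) _))
      ((I L).sum_mem fun p _ => I_smul_mem _ (Fn_mul_F_sub_mem_I h hL m i j p))

theorem Cn_sub_inclU_mem_I (h : K ≤ L) (hL : L = K + 1) (m : ℕ) :
    Cn L (m + 1) - inclU h (Cn K (m + 1)) ∈ I L := by
  rw [Cn, Cn, sum_idx h hL, map_sum, add_sub_right_comm, ← Finset.sum_sub_distrib]
  exact (I L).add_mem ((I L).sum_mem fun k _ => Fn_sub_inclU_mem_I h hL m k k)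
    ((I L).sum_mem fun p _ => Fn_mem_I m (topIdx_abs hL p) _)

theorem eq_of_sub_inclU_mem_I (h : K ≤ L) (hL : L = K + 1) {X : U L} {Y Z : U K}
    (hY : X - inclU h Y ∈ I L) (hZ : X - inclU h Z ∈ I L) : Y = Z := by
  rw [← sub_eq_zero]
  refine eq_zero_of_inclU_mem_I h hL ?_
  have e := (I L).sub_mem hZ hY
  rwa [sub_sub_sub_cancel_left, ← map_sub] at e

end Projection

/-! ### The homomorphism α -/

section Main

variable {N M : ℕ}

theorem mem_A_of_sub_inclU_mem_I (h : N + (M - 1) ≤ N + M) (hL : N + M = N + (M - 1) + 1)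
    {X : U (N + M)} (hX : X ∈ A N M) {Z : U (N + (M - 1))} (hZ : X - inclU h Z ∈ I (N + M)) :
    Z ∈ A N (M - 1) := by
  rw [mem_A_iff] at hX ⊢
  intro i j hi hj
  have e := hX (i.cast h) (j.cast h) hi hj
  rw [← sub_eq_zero]
  refine eq_zero_of_inclU_mem_I h hL ?_
  -- The centralizing relation for X descends modulo I_{N+M}, and elements of U(𝔮_{N+M-1}) are
  -- detected modulo the ideal. X' is X or its parity twist, according to the degree of F_{ij}.
  have key : ∀ (X' : U (N + M)) (Z' : U (N + (M - 1))), X' - inclU h Z' ∈ I (N + M) →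
      X * F (i.cast h) (j.cast h) = F (i.cast h) (j.cast h) * X' →
      inclU h (Z * F i j - F i j * Z') ∈ I (N + M) := by
    intro X' Z' hZ' e
    have e2 : inclU h (Z * F i j - F i j * Z')
        = inclU h (F i j) * (X' - inclU h Z') - (X - inclU h Z) * F (i.cast h) (j.cast h) := by
      rw [map_sub, map_mul, map_mul, mul_sub, sub_mul, inclU_F, e]
      abel
    rw [e2]
    exact (I (N + M)).sub_mem (inclU_mul_mem_I h hL _ hZ') (I_mul_mem hZ _)
  have ei : (i.cast h).2 + (j.cast h).2 = i.2 + j.2 := rfl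
  rw [ei] at e
  split_ifs at e ⊢
  · exact key X Z hZ e
  · refine key _ _ ?_ e
    rw [← parityU_inclU, ← map_sub]
    exact parityU_mem_I hZ

theorem exists_mem_A_sub_inclU_mem_I (h : N + (M - 1) ≤ N + M) (hL : N + M = N + (M - 1) + 1)
    (X : A N M) : ∃ Z : A N (M - 1), (X : U (N + M)) - inclU h (Z : U (N + (M - 1)))
      ∈ I (N + M) := by
  have hX := mem_A_iff.1 X.2 (topIdx hL 0) (topIdx hL 0)
    (by rw [topIdx_abs]; omega) (by rw [topIdx_abs]; omega)
  have h0 : (topIdx hL 0).2 + (topIdx hL 0).2 = 0 := add_zero _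
  rw [if_pos h0] at hX
  obtain ⟨Z, hZ⟩ := exists_sub_inclU_mem_I h hL hX
  exact ⟨⟨Z, mem_A_of_sub_inclU_mem_I h hL X.2 hZ⟩, hZ⟩

/-- The homomorphism `A_N^M → A_N^{M-1}`, the projection along `I_{N+M}`. -/
noncomputable def alpha (h : N + (M - 1) ≤ N + M) (hL : N + M = N + (M - 1) + 1) :
    A N M →ₐ[ℂ] A N (M - 1) :=
  have spec := fun X => (exists_mem_A_sub_inclU_mem_I h hL X).choose_spec
  have uniq : ∀ (X : A N M) (Z : A N (M - 1)),
      (X : U (N + M)) - inclU h (Z : U (N + (M - 1))) ∈ I (N + M) →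
      (exists_mem_A_sub_inclU_mem_I h hL X).choose = Z :=
    fun X _ hZ => Subtype.ext (eq_of_sub_inclU_mem_I h hL (spec X) hZ)
  { toFun := fun X => (exists_mem_A_sub_inclU_mem_I h hL X).choose
    map_one' := uniq 1 1 (by
      rw [OneMemClass.coe_one, OneMemClass.coe_one, map_one, sub_self]
      exact (I _).zero_mem)
    map_mul' := fun X Y => uniq _ _ (by
      set X' := (exists_mem_A_sub_inclU_mem_I h hL X).choose with hX'
      set Y' := (exists_mem_A_sub_inclU_mem_I h hL Y).choose with hY'
      -- The first summand uses that I is a right ideal, the second that U(𝔮_{N+M-1}) preserves I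
      -- from the left.
      have e : ((X * Y : A N M) : U (N + M)) - inclU h ((X' * Y' : A N (M - 1)) : U (N + (M - 1)))
          = ((X : U (N + M)) - inclU h (X' : U (N + (M - 1)))) * (Y : U (N + M))
            + inclU h (X' : U (N + (M - 1)))
              * ((Y : U (N + M)) - inclU h (Y' : U (N + (M - 1)))) := by
        rw [MulMemClass.coe_mul, MulMemClass.coe_mul, map_mul, sub_mul, mul_sub]
        abel
      rw [e]
      exact (I _).add_mem (I_mul_mem (spec X) _) (inclU_mul_mem_I h hL _ (spec Y)))
    map_zero' := uniq 0 0 (by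
      rw [ZeroMemClass.coe_zero, ZeroMemClass.coe_zero, map_zero, sub_self]
      exact (I _).zero_mem)
    map_add' := fun X Y => uniq _ _ (by
      rw [AddMemClass.coe_add, AddMemClass.coe_add, map_add, add_sub_add_comm]
      exact (I _).add_mem (spec X) (spec Y))
    commutes' := fun c => uniq _ _ (by
      rw [Subalgebra.coe_algebraMap, Subalgebra.coe_algebraMap, AlgHom.commutes, sub_self]
      exact (I _).zero_mem) }

theorem sub_inclU_alpha_mem_I (h : N + (M - 1) ≤ N + M) (hL : N + M = N + (M - 1) + 1)
    (X : A N M) : (X : U (N + M)) - inclU h (alpha h hL X : U (N + (M - 1))) ∈ I (N + M) :=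
  (exists_mem_A_sub_inclU_mem_I h hL X).choose_spec

theorem alpha_eq (h : N + (M - 1) ≤ N + M) (hL : N + M = N + (M - 1) + 1)
    {X : A N M} {Z : U (N + (M - 1))} (hZ : (X : U (N + M)) - inclU h Z ∈ I (N + M)) :
    (alpha h hL X : U (N + (M - 1))) = Z :=
  eq_of_sub_inclU_mem_I h hL (sub_inclU_alpha_mem_I h hL X) hZ

end Main

end QueerLie

theorem proposition1p4 (N M : ℕ) (hM : 1 ≤ M) :
    (∀ Z : QueerLie.U (N + (M - 1)),
      QueerLie.inclU (Nat.add_le_add_left (Nat.sub_le M 1) N) Z ∈ QueerLie.I (N + M) → Z = 0) ∧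
    ∃ α : QueerLie.A N M →ₐ[ℂ] QueerLie.A N (M - 1),
      (∀ X : QueerLie.A N M,
        (X : QueerLie.U (N + M)) -
          QueerLie.inclU (Nat.add_le_add_left (Nat.sub_le M 1) N)
            (α X : QueerLie.U (N + (M - 1))) ∈ QueerLie.I (N + M)) ∧
      (∀ n : ℕ, 1 ≤ n → ∀ i j : QueerLie.Idx N,
        ∃ h : QueerLie.Fn (N + M) n (i.cast (Nat.le_add_right N M))
            (j.cast (Nat.le_add_right N M)) ∈ QueerLie.A N M,
          (α ⟨_, h⟩ : QueerLie.U (N + (M - 1))) =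
            QueerLie.Fn (N + (M - 1)) n (i.cast (Nat.le_add_right N (M - 1)))
              (j.cast (Nat.le_add_right N (M - 1)))) ∧
      (∀ n : ℕ, 1 ≤ n →
        ∃ h : QueerLie.Cn (N + M) n ∈ QueerLie.A N M,
          (α ⟨_, h⟩ : QueerLie.U (N + (M - 1))) = QueerLie.Cn (N + (M - 1)) n) := by
  -- Here M ≥ 1 is needed, the subtraction being truncated.
  have hL : N + M = N + (M - 1) + 1 := by omega
  have hK : N + (M - 1) ≤ N + M := Nat.add_le_add_left (Nat.sub_le M 1) N
  refine ⟨fun Z hZ => QueerLie.eq_zero_of_inclU_mem_I hK hL hZ, QueerLie.alpha hK hL,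
    QueerLie.sub_inclU_alpha_mem_I hK hL, ?_, ?_⟩
  · intro n hn i j
    obtain ⟨m, rfl⟩ : ∃ m, n = m + 1 := ⟨n - 1, by omega⟩
    -- Casting an index from N to N + (M - 1) and then to N + M agrees definitionally with the
    -- direct cast.
    exact ⟨QueerLie.Fn_mem_A m i j, QueerLie.alpha_eq hK hL
      (QueerLie.Fn_sub_inclU_mem_I hK hL m (i.cast (Nat.le_add_right N (M - 1)))
        (j.cast (Nat.le_add_right N (M - 1))))⟩
  · intro n hn
    obtain ⟨m, rfl⟩ : ∃ m, n = m + 1 := ⟨n - 1, by omega⟩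
    exact ⟨QueerLie.Cn_mem_A m, QueerLie.alpha_eq hK hL (QueerLie.Cn_sub_inclU_mem_I hK hL m)⟩
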